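/- Let $n\ge 3$, $m\ge 1$, $r\ge 1$ be integers, let $g=\sum_i\varepsilon_i\,dx_i^2$ with $\varepsilon_i=\pm1$ be a pseudo-Euclidean metric on $\mathbb R^n$, let $\alpha\in\mathbb R^n$ and $\xi=\sum_i\alpha_ix_i$. Let $(F_1^m,g_{F_1})$ and $(F_2^r,g_{F_2})$ be non-empty Ricci-flat semi-Riemannian manifolds of dimensions $m$ and $r$. Let $f,h,\varphi$ be smooth functions of $\xi$ of one of the following kinds. (A) $\sum_i\varepsilon_i\alpha_i^2=\varepsilon_{i_0}$ for some $i_0$, and $$f=c_1\,(d\xi+c)^{-1/d},\qquad h=c_2\,(d\xi+c)^{-N/d},\qquad \varphi=c_3\,(d\xi+c)^{-k/d},\qquad d=a-rN,$$ for $\xi\in J=\{d\xi+c>0\}$, where $k,c_1,c_2,c_3>0$, $c\in\mathbb R$, $a=(n-2)k-m$, $b=m(2k+1)-(n-2)k^2$, and either $r\ne1$, $r(k+a)^2\ge(r-1)(a^2-b)$ and $N$ is one of the two numbers $\dfrac{r(k+a)\pm\sqrt{r^2(k+a)^2-r(r-1)(a^2-b)}}{r(r-1)}$, or $r=1$, $k+a\ne0$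 and $N=\dfrac{a^2-b}{2(k+a)}$. (B) $\sum_i\varepsilon_i\alpha_i^2=0$, and $f,h,\varphi$ are smooth for $\xi$ in an open set $J\subseteq\mathbb R$ and satisfy there $$-rf\varphi h''-2rf\varphi'h'+\big[(n-2)f\varphi''-m\varphi f''-2m\varphi'f'\big]h=0 .$$ Let $U=\{x\in\mathbb R^n:\ \xi\in J,\ f(\xi)>0,\ h(\xi)>0,\ \varphi(\xi)\ne0\}$ and $\overline g=\varphi^{-2}g$ on $U$. Then $(U\times_fF_1^m)\times_hF_2^r$ with the metric $\widetilde g=(\overline g\oplus f^2g_{F_1})\oplus h^2g_{F_2}$ is a Ricci-flat Einstein semi-Riemannian manifold. Moreover, in case (A) the base $B=U\times_fF_1$ with the metric $\overline g\oplus f^2g_{F_1}$ is not locally conformally flat. In case (B), if $\alpha\ne0$ and $U\ne\emptyset$, the base $B$ is not locally conformally flat unless $F_1$ is flat and $(f\varphi)''(\xi)=0$ at all points of $U$ (in this excluded degenerate situation $\overline g\oplus f^2g_{F_1}$ is conformal to a product of flat metrics). -/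

import Mathlib

set_option maxSynthPendingDepth 3

open scoped Manifold ContDiff

noncomputable section

namespace SemiRiem

/-! ### Curvature of a semi-Riemannian metric in coordinates

`G : E → E →L[ℝ] E →L[ℝ] ℝ` is a metric on (an open subset of) a vector space `E`. -/

section Coordinates

variable {E : Type*} [NormedAddCommGroup E] [NormedSpace ℝ E]

/-- The Christoffel symbols of the first kind,
`[v, w; z] = (1/2) (D_v G (w, z) + D_w G (v, z) - D_z G (v, w))`, where `D = DG` is the derivative
of the metric at a point. -/
def koszul (D : E →L[ℝ] E →L[ℝ] E →L[ℝ] ℝ) : E →L[ℝ] E →L[ℝ] E →L[ℝ] ℝ :=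
  let T : (E →L[ℝ] E →L[ℝ] ℝ) →L[ℝ] (E →L[ℝ] E →L[ℝ] ℝ) :=
    (ContinuousLinearMap.flipₗᵢ ℝ E E ℝ).toContinuousLinearEquiv.toContinuousLinearMap
  let S : E →L[ℝ] E →L[ℝ] E →L[ℝ] ℝ := D + D.flip - T.comp D.flip
  (1 / 2 : ℝ) • S

theorem koszul_apply (D : E →L[ℝ] E →L[ℝ] E →L[ℝ] ℝ) (v w z : E) :
    koszul D v w z = (1 / 2) * (D v w z + D w v z - D z v w) := by
  simp [koszul]

/-- The Christoffel symbols (of the second kind) of the Levi-Civita connection at `x`,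
`Γ(v, w) = Γ^k_{ij} v^i w^j e_k`: the first kind, with the last index raised by the inverse metric. -/
def christoffel (G : E → E →L[ℝ] E →L[ℝ] ℝ) (x : E) : E →L[ℝ] E →L[ℝ] E :=
  (ContinuousLinearMap.compL ℝ E (E →L[ℝ] ℝ) E (G x).inverse) ∘L koszul (fderiv ℝ G x)

theorem christoffel_apply (G : E → E →L[ℝ] E →L[ℝ] ℝ) (x v w : E) :
    christoffel G x v w = (G x).inverse (koszul (fderiv ℝ G x) v w) := rfl

/-- The endomorphism `u ↦ R(u, v) w` of the Riemann curvature tensor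
`R(u, v) w = ∇_u ∇_v w - ∇_v ∇_u w` (for constant `u`, `v`, `w`) at the point `x`. -/
def riemann (G : E → E →L[ℝ] E →L[ℝ] ℝ) (x v w : E) : E →L[ℝ] E :=
  ((fderiv ℝ (christoffel G) x).flip v).flip w - (fderiv ℝ (christoffel G) x v).flip w
    + (christoffel G x).flip (christoffel G x v w)
    - (christoffel G x v) ∘L ((christoffel G x).flip w)

theorem riemann_apply (G : E → E →L[ℝ] E →L[ℝ] ℝ) (x u v w : E) :
    riemann G x v w u =
      fderiv ℝ (christoffel G) x u v w - fderiv ℝ (christoffel G) x v u w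
        + christoffel G x u (christoffel G x v w) - christoffel G x v (christoffel G x u w) := by
  simp [riemann]

/-- The Ricci tensor `Ric(v, w) = trace (u ↦ R(u, v) w)` at the point `x`. -/
def ricci (G : E → E →L[ℝ] E →L[ℝ] ℝ) (x v w : E) : ℝ :=
  LinearMap.trace ℝ E (riemann G x v w : E →ₗ[ℝ] E)

end Coordinates

/-! ### Semi-Riemannian manifolds -/

/-- The pullback `(v, w) ↦ b (A v, A w)` of a bilinear form. -/
def pullbackForm {V W : Type*} [AddCommGroup V] [TopologicalSpace V] [Module ℝ V]
    [AddCommGroup W] [TopologicalSpace W] [Module ℝ W]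
    (A : V →L[ℝ] W) (b : W →L[ℝ] W →L[ℝ] ℝ) : V →L[ℝ] V →L[ℝ] ℝ :=
  (ContinuousLinearMap.precomp ℝ A).comp (b.comp A)

theorem pullbackForm_apply {V W : Type*} [AddCommGroup V] [TopologicalSpace V] [Module ℝ V]
    [AddCommGroup W] [TopologicalSpace W] [Module ℝ W]
    (A : V →L[ℝ] W) (b : W →L[ℝ] W →L[ℝ] ℝ) (v w : V) :
    pullbackForm A b v w = b (A v) (A w) := rfl

section Manifolds

variable {E : Type*} [NormedAddCommGroup E] [NormedSpace ℝ E]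
  {H : Type*} [TopologicalSpace H] (I : ModelWithCorners ℝ E H)
  (M : Type*) [TopologicalSpace M] [ChartedSpace H M]

/-- Fields of bilinear forms on the tangent spaces of a manifold (without any regularity). -/
abbrev BilinField : Type _ :=
  ∀ p : M, TangentSpace I p →L[ℝ] TangentSpace I p →L[ℝ] ℝ

variable {I M}

/-- The field `g` read in the chart around `p` (all manifolds below have no boundary): its pullback
under the inverse chart. It is meaningful on the target of the chart. -/
def coordMetric (g : BilinField I M) (p : M) (x : E) : E →L[ℝ] E →L[ℝ] ℝ :=
  pullbackForm (V := E) (mfderiv 𝓘(ℝ, E) I (extChartAt I p).symm x) (g ((extChartAt I p).symm x))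

/-- `g` is a semi-Riemannian metric: a smooth field of symmetric nondegenerate bilinear forms of
constant index (the index is the largest dimension of a negative definite subspace). -/
structure IsSemiRiemannianMetric (g : BilinField I M) : Prop where
  contDiffOn : ∀ p : M, ContDiffOn ℝ ∞ (coordMetric g p) (extChartAt I p).target
  symm : ∀ (p : M) (v w : TangentSpace I p), g p v w = g p w v
  nondegenerate : ∀ (p : M) (v : TangentSpace I p), (∀ w : TangentSpace I p, g p v w = 0) → v = 0
  constant_index : ∃ ν : ℕ, ∀ p : M,
    sigNeg (LinearMap.BilinMap.toQuadraticMap (g p).toLinearMap₁₂) = ν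

/-- The Riemann tensor `R(u, v) w` of `g` at `p`, in the coordinates of the chart around `p`. -/
def curvatureAt (g : BilinField I M) (p : M) (u v w : E) : E :=
  riemann (coordMetric g p) (extChartAt I p p) v w u

/-- The Ricci tensor `Ric(v, w)` of `g` at `p`, in the coordinates of the chart around `p`. -/
def ricciAt (g : BilinField I M) (p : M) (v w : E) : ℝ :=
  ricci (coordMetric g p) (extChartAt I p p) v w

/-- `g` is flat: its Riemann tensor vanishes on `s`. -/
def IsFlatOn (g : BilinField I M) (s : Set M) : Prop :=
  ∀ p ∈ s, ∀ u v w : E, curvatureAt g p u v w = 0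

/-- `g` is Einstein with constant Ricci curvature `ρ`, that is, `Ric = ρ g`. -/
def IsEinstein (g : BilinField I M) (ρ : ℝ) : Prop :=
  ∀ (p : M) (v w : E), ricciAt g p v w = ρ * coordMetric g p (extChartAt I p p) v w

/-- `g` is Ricci-flat, that is, Einstein with `Ric = 0`. -/
def IsRicciFlat (g : BilinField I M) : Prop := IsEinstein g 0

/-- `g` is locally conformally flat: every point has an open neighbourhood `V` on which some
conformal metric `μ g`, with `μ` a positive smooth function on `V`, is flat. -/
def IsLocallyConformallyFlat (g : BilinField I M) : Prop :=
  ∀ p : M, ∃ V : Set M, IsOpen V ∧ p ∈ V ∧ ∃ μ : M → ℝ, ContMDiffOn I 𝓘(ℝ, ℝ) ∞ μ V ∧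
    (∀ q ∈ V, 0 < μ q) ∧ IsFlatOn (fun q => μ q • g q) V

/-- The warped product metric `g_B ⊕ f² g_F = π_B^* g_B + (f ∘ π_B)² π_F^* g_F` on `B × F`. -/
def warpedProduct {E' : Type*} [NormedAddCommGroup E'] [NormedSpace ℝ E']
    {H' : Type*} [TopologicalSpace H'] {I' : ModelWithCorners ℝ E' H'}
    {F : Type*} [TopologicalSpace F] [ChartedSpace H' F]
    (gB : BilinField I M) (f : M → ℝ) (gF : BilinField I' F) : BilinField (I.prod I') (M × F) :=
  fun p => pullbackForm (mfderiv (I.prod I') I Prod.fst p) (gB p.1)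
    + (f p.1) ^ 2 • pullbackForm (mfderiv (I.prod I') I' Prod.snd p) (gF p.2)

end Manifolds

/-! ### The base metric and the functions -/

/-- The pseudo-Euclidean form `∑ i, ε i * v i * w i` on `ℝⁿ`. -/
def pseudoEuclidean {n : ℕ} (ε : Fin n → ℝ) :
    EuclideanSpace ℝ (Fin n) →L[ℝ] EuclideanSpace ℝ (Fin n) →L[ℝ] ℝ :=
  ∑ i, ε i • (EuclideanSpace.proj i).smulRight
    (EuclideanSpace.proj i : EuclideanSpace ℝ (Fin n) →L[ℝ] ℝ)

theorem pseudoEuclidean_apply {n : ℕ} (ε : Fin n → ℝ) (v w : EuclideanSpace ℝ (Fin n)) :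
    pseudoEuclidean ε v w = ∑ i, ε i * (v i * w i) := by
  simp [pseudoEuclidean]

/-- The basic invariant `ξ = ∑ i, α i * x i` of the translations along its level hyperplanes. -/
def xi {n : ℕ} (α : Fin n → ℝ) (x : EuclideanSpace ℝ (Fin n)) : ℝ := ∑ i, α i * x i

/-- The metric `φ(ξ)⁻² g` on an open subset `U` of the pseudo-Euclidean space `(ℝⁿ, g)`. -/
def conformalMetric {n : ℕ} (ε α : Fin n → ℝ) (φ : ℝ → ℝ)
    (U : TopologicalSpace.Opens (EuclideanSpace ℝ (Fin n))) : BilinField (𝓡 n) U :=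
  fun p => (1 / φ (xi α p) ^ 2) •
    pullbackForm (mfderiv (𝓡 n) (𝓡 n) (Subtype.val : U → EuclideanSpace ℝ (Fin n)) p)
      (pseudoEuclidean ε)

/-- The open set `{x ∈ ℝⁿ | f(ξ) > 0, h(ξ) > 0, φ(ξ) ≠ 0}`, for functions `f`, `h`, `φ` of `ξ`
which are defined for `ξ ∈ J`. -/
def solutionDomain {n : ℕ} (α : Fin n → ℝ) (J : Set ℝ) (f h φ : ℝ → ℝ) :
    Set (EuclideanSpace ℝ (Fin n)) :=
  {x | xi α x ∈ J ∧ 0 < f (xi α x) ∧ 0 < h (xi α x) ∧ φ (xi α x) ≠ 0}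

/-- `a = (n - 2) k - m`. -/
def coeffA (n m : ℕ) (k : ℝ) : ℝ := ((n : ℝ) - 2) * k - m

/-- `b = m (2 k + 1) - (n - 2) k²`. -/
def coeffB (n m : ℕ) (k : ℝ) : ℝ := (m : ℝ) * (2 * k + 1) - ((n : ℝ) - 2) * k ^ 2

/-- `N` is one of the two numbers
`N_± = (r (k + a) ± √(r² (k + a)² - r (r - 1) (a² - b))) / (r (r - 1))`, for `r ≠ 1`. -/
def IsExponentOfNeOne (n m r : ℕ) (k N : ℝ) : Prop :=
  r ≠ 1 ∧
  ((r : ℝ) - 1) * (coeffA n m k ^ 2 - coeffB n m k) ≤ r * (k + coeffA n m k) ^ 2 ∧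
  (N = (r * (k + coeffA n m k) +
      √((r : ℝ) ^ 2 * (k + coeffA n m k) ^ 2
        - r * ((r : ℝ) - 1) * (coeffA n m k ^ 2 - coeffB n m k))) / (r * ((r : ℝ) - 1)) ∨
   N = (r * (k + coeffA n m k) -
      √((r : ℝ) ^ 2 * (k + coeffA n m k) ^ 2
        - r * ((r : ℝ) - 1) * (coeffA n m k ^ 2 - coeffB n m k))) / (r * ((r : ℝ) - 1)))

/-- `N = (a² - b) / (2 (k + a))`, for `r = 1`, where `k + a ≠ 0`. -/
def IsExponentOfEqOne (n m r : ℕ) (k N : ℝ) : Prop :=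
  r = 1 ∧ k + coeffA n m k ≠ 0 ∧
  N = (coeffA n m k ^ 2 - coeffB n m k) / (2 * (k + coeffA n m k))

/-- The explicit solutions: with `d = a - r N`,
`f = c₁ (d ξ + c) ^ (-1/d)`, `h = c₂ (d ξ + c) ^ (-N/d)`, `φ = c₃ (d ξ + c) ^ (-k/d)`
on `J = {ξ | d ξ + c > 0}`. (Here `d ≠ 0` for each of the admissible exponents `N`.) -/
def IsPowerSolution (n m r : ℕ) (J : Set ℝ) (f h φ : ℝ → ℝ) : Prop :=
  ∃ k c c₁ c₂ c₃ N d : ℝ, 0 < k ∧ 0 < c₁ ∧ 0 < c₂ ∧ 0 < c₃ ∧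
    (IsExponentOfNeOne n m r k N ∨ IsExponentOfEqOne n m r k N) ∧
    d = coeffA n m k - r * N ∧
    J = {t | 0 < d * t + c} ∧
    ∀ t ∈ J, f t = c₁ * (d * t + c) ^ (-1 / d) ∧ h t = c₂ * (d * t + c) ^ (-N / d) ∧
      φ t = c₃ * (d * t + c) ^ (-k / d)

/-- Smooth functions `f`, `h`, `φ` on the open set `J ⊆ ℝ` with
`-r f φ h'' - 2 r f φ' h' + [(n - 2) f φ'' - m φ f'' - 2 m φ' f'] h = 0`. -/
def IsNullSolution (n m r : ℕ) (J : Set ℝ) (f h φ : ℝ → ℝ) : Prop :=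
  IsOpen J ∧ ContDiffOn ℝ ∞ f J ∧ ContDiffOn ℝ ∞ h J ∧ ContDiffOn ℝ ∞ φ J ∧
  ∀ t ∈ J,
    -(r : ℝ) * f t * φ t * deriv (deriv h) t - 2 * r * f t * deriv φ t * deriv h t
      + (((n : ℝ) - 2) * f t * deriv (deriv φ) t - m * φ t * deriv (deriv f) t
        - 2 * m * deriv φ t * deriv f t) * h t = 0

end SemiRiem

end

/-! In product charts the total metric is `w₀ b ⊕ w₁ B₁ ⊕ w₂ B₂` with `b` constant, `B₁`, `B₂`
Ricci-flat, and weights `φ⁻²`, `f²`, `h²` depending only on the linear form ξ. All warping is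
treated at once: this metric is the unwarped product `B` composed with a block-scalar endomorphism
`W(ξ)`, where W' = 2 W L and L has blocks l₀ = -φ'/φ, l₁ = f'/f, l₂ = h'/h. The Levi-Civita
connection is that of `B` plus an explicit correction, and L is parallel for `B`, so the curvature
(`WarpData.riemann_eq`) involves only L, K = L' + L² - 2 l₀ L and the gradient of ξ. Tracing
(`WarpData.ricci_eq`) leaves two terms: one proportional to dξ ⊗ dξ with coefficient 2 k₀ - tr K,
and one proportional to |∇ξ|² times L' + (tr L - 2 l₀) L. The vanishing of the first coefficient is
the scalar differential equation of case (B). The second term vanishes when α is null; otherwise the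
system L' = (2 l₀ - tr L) L suffices.

For the power functions every block of L is a constant over s = dξ + c, so the system amounts to d =
a - rN, and the scalar equation becomes a polynomial equation for N (`exponent_eq`), quadratic if r
≠ 1 and linear if r = 1, whose solutions are the given exponents.

For conformal flatness, the base metric is conformal to g ⊕ (fφ)² g₁. If it is conformally flat, its
curvature is a Kulkarni-Nomizu product with some symmetric τ (`exists_kulkarniNomizu_of_conformal`).
Comparing blocks (`warped_of_conformally_flat`) gives τ = 0 on the flat factor because n ≥ 3, then τ
= 0 on the fibre, (fφ)'' = 0, and constant curvature |α|² ((fφ)')² for g₁. If α is null, g₁ is flat,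
which is the excluded case. In case (A), (fφ)'' = 0 forces d = -(1 + k) and this curvature is
nonzero, so the Ricci-flat fibre has dimension m = 1; the equation for N then rules out d = -(1 +
k). -/

noncomputable section

namespace SemiRiem

open Filter Topology

/-! ### Levi-Civita connection and curvature in coordinates. -/

section CoordinateTheory

variable {E : Type*} [NormedAddCommGroup E] [NormedSpace ℝ E]

/-- `G` is of class `C²` at `x`, and symmetric and nondegenerate near `x`. -/
structure MetricGerm (G : E → E →L[ℝ] E →L[ℝ] ℝ) (x : E) : Prop where
  contDiffAt : ContDiffAt ℝ 2 G x
  symm : ∀ᶠ y in 𝓝 x, ∀ v w, G y v w = G y w v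
  nondeg : ∀ᶠ y in 𝓝 x, ∀ v, (∀ w, G y v w = 0) → v = 0

theorem fderiv_apply_two {F F' : Type*} [NormedAddCommGroup F] [NormedSpace ℝ F]
    [NormedAddCommGroup F'] [NormedSpace ℝ F'] {G : E → F →L[ℝ] F →L[ℝ] F'} {x : E}
    (hG : DifferentiableAt ℝ G x) (u : E) (v w : F) :
    fderiv ℝ G x u v w = fderiv ℝ (fun y => G y v w) x u := by
  have h := ((hG.hasFDerivAt.clm_apply (hasFDerivAt_const v x)).clm_apply
    (hasFDerivAt_const w x)).fderiv
  rw [h]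
  simp

theorem koszul_comm {D : E →L[ℝ] E →L[ℝ] E →L[ℝ] ℝ} (hD : ∀ u v w, D u v w = D u w v) (v w z : E) :
    koszul D v w z = koszul D w v z := by
  rw [koszul_apply, koszul_apply, hD z v w]; ring

/-- This is the compatibility of the Levi-Civita connection with the metric, written with symbols of
the first kind. -/
theorem koszul_add_koszul {D : E →L[ℝ] E →L[ℝ] E →L[ℝ] ℝ} (hD : ∀ u v w, D u v w = D u w v)
    (u v w : E) : koszul D u v w + koszul D u w v = D u v w := by
  rw [koszul_apply, koszul_apply, hD u w v, hD w u v, hD v u w]; ring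

theorem isInvertible_of_nondeg [FiniteDimensional ℝ E] (b : E →L[ℝ] E →L[ℝ] ℝ)
    (hb : ∀ v, (∀ w, b v w = 0) → v = 0) : b.IsInvertible := by
  have hinj : Function.Injective (b : E →ₗ[ℝ] E →L[ℝ] ℝ) := by
    rw [← LinearMap.ker_eq_bot, LinearMap.ker_eq_bot']
    intro v hv
    exact hb v fun w => by
      have : b v = 0 := hv
      rw [this]; rfl
  have hrank : Module.finrank ℝ E = Module.finrank ℝ (E →L[ℝ] ℝ) := by
    rw [← (LinearMap.toContinuousLinearMap : (E →ₗ[ℝ] ℝ) ≃ₗ[ℝ] E →L[ℝ] ℝ).finrank_eq]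
    exact (Subspace.dual_finrank_eq (K := ℝ) (V := E)).symm
  exact ⟨(LinearEquiv.ofInjectiveOfFinrankEq _ hinj hrank).toContinuousLinearEquiv, by
    ext v w; rfl⟩

namespace MetricGerm

variable {G : E → E →L[ℝ] E →L[ℝ] ℝ} {x : E}

theorem eventually (hG : MetricGerm G x) : ∀ᶠ y in 𝓝 x, MetricGerm G y := by
  filter_upwards [hG.contDiffAt.eventually (by simp), hG.symm.eventually_nhds,
    hG.nondeg.eventually_nhds] with y h1 h2 h3
  exact ⟨h1, h2, h3⟩

theorem differentiableAt (hG : MetricGerm G x) : DifferentiableAt ℝ G x :=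
  hG.contDiffAt.differentiableAt (by simp)

theorem symm_self (hG : MetricGerm G x) (v w : E) : G x v w = G x w v := hG.symm.self_of_nhds v w

theorem nondeg_self (hG : MetricGerm G x) {v : E} (hv : ∀ w, G x v w = 0) : v = 0 :=
  hG.nondeg.self_of_nhds v hv

theorem ext (hG : MetricGerm G x) {v v' : E} (h : ∀ w, G x v w = G x v' w) : v = v' :=
  sub_eq_zero.mp <| hG.nondeg_self fun w => by simp [h w]

theorem fderiv_symm (hG : MetricGerm G x) (u v w : E) :
    fderiv ℝ G x u v w = fderiv ℝ G x u w v := by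
  rw [fderiv_apply_two hG.differentiableAt, fderiv_apply_two hG.differentiableAt]
  congr 1
  apply Filter.EventuallyEq.fderiv_eq
  filter_upwards [hG.symm] with y hy using hy v w

variable [FiniteDimensional ℝ E]

theorem isInvertible (hG : MetricGerm G x) : (G x).IsInvertible :=
  isInvertible_of_nondeg _ hG.nondeg.self_of_nhds

theorem apply_christoffel (hG : MetricGerm G x) (v w z : E) :
    G x (christoffel G x v w) z = koszul (fderiv ℝ G x) v w z := by
  rw [christoffel_apply, hG.isInvertible.self_apply_inverse]

/-- By nondegeneracy the Koszul formula determines the connection; explicit candidates are verified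
this way below, without computing an inverse metric. -/
theorem christoffel_eq (hG : MetricGerm G x) {v w c : E}
    (h : ∀ z, G x c z = koszul (fderiv ℝ G x) v w z) : christoffel G x v w = c :=
  hG.ext fun z => by rw [hG.apply_christoffel, h]

theorem christoffel_comm (hG : MetricGerm G x) (v w : E) :
    christoffel G x v w = christoffel G x w v :=
  hG.christoffel_eq fun z => by
    rw [hG.apply_christoffel, koszul_comm hG.fderiv_symm]

theorem differentiableAt_christoffel (hG : MetricGerm G x) :
    DifferentiableAt ℝ (christoffel G) x := by
  have h1 : DifferentiableAt ℝ (fun y => (G y).inverse) x :=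
    ((hG.isInvertible.contDiffAt_map_inverse (n := 1)).differentiableAt (by simp)).comp x
      hG.differentiableAt
  have h2 : DifferentiableAt ℝ (fderiv ℝ G) x :=
    (hG.contDiffAt.fderiv_right (m := 1) (by norm_num)).differentiableAt (by simp)
  have h3 : DifferentiableAt ℝ (fun y => koszul (fderiv ℝ G y)) x := by
    have hT : DifferentiableAt ℝ (fun y => ((ContinuousLinearMap.flipₗᵢ ℝ E E
      ℝ).toContinuousLinearEquiv.toContinuousLinearMap).comp (fderiv ℝ G y).flip) x :=
      (differentiableAt_const _).clm_comp
        ((ContinuousLinearMap.flipₗᵢ ℝ E E (E →L[ℝ] ℝ)).toContinuousLinearEquiv.differentiableAt.comp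
          x h2)
    have hf : DifferentiableAt ℝ (fun y => (fderiv ℝ G y).flip) x :=
      (ContinuousLinearMap.flipₗᵢ ℝ E E (E →L[ℝ] ℝ)).toContinuousLinearEquiv.differentiableAt.comp
          x h2
    exact ((h2.add hf).sub hT).const_smul (1 / 2 : ℝ)
  exact ((ContinuousLinearMap.compL ℝ E (E →L[ℝ] ℝ) E).differentiableAt.comp x h1).clm_comp h3

end MetricGerm

theorem christoffel_congr {G G' : E → E →L[ℝ] E →L[ℝ] ℝ} {x : E} (h : G =ᶠ[𝓝 x] G') :
    christoffel G =ᶠ[𝓝 x] christoffel G' := by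
  filter_upwards [h.eventually_nhds] with y hy
  have hy : G =ᶠ[𝓝 y] G' := hy
  rw [christoffel, christoffel, hy.fderiv_eq, hy.eq_of_nhds]

theorem riemann_congr {G G' : E → E →L[ℝ] E →L[ℝ] ℝ} {x : E} (h : G =ᶠ[𝓝 x] G') (v w : E) :
    riemann G x v w = riemann G' x v w := by
  have h1 := christoffel_congr h
  rw [riemann, riemann, h1.fderiv_eq, h1.eq_of_nhds]

theorem ricci_congr {G G' : E → E →L[ℝ] E →L[ℝ] ℝ} {x : E} (h : G =ᶠ[𝓝 x] G') (v w : E) :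
    ricci G x v w = ricci G' x v w := by
  rw [ricci, ricci, riemann_congr h]

/-- The curvature of a connection `Γ + S`. -/
theorem riemann_of_christoffel_eq_add [FiniteDimensional ℝ E]
    {G B : E → E →L[ℝ] E →L[ℝ] ℝ} {x : E} (hG : MetricGerm G x)
    (hB : MetricGerm B x) {S : E → E → E → E}
    (h : ∀ᶠ y in 𝓝 x, ∀ v w, christoffel G y v w = christoffel B y v w + S y v w)
    {T : E → E → E →L[ℝ] E} (hS : ∀ v w, HasFDerivAt (fun y => S y v w) (T v w) x) (u v w : E) :
    riemann G x v w u = riemann B x v w u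
      + (T v w u - T u w v)
      + (christoffel B x u (S x v w) + S x u (christoffel B x v w)
        - christoffel B x v (S x u w) - S x v (christoffel B x u w))
      + (S x u (S x v w) - S x v (S x u w)) := by
  have key : ∀ u v w : E, fderiv ℝ (christoffel G) x u v w
      = fderiv ℝ (christoffel B) x u v w + T v w u := by
    intro u v w
    rw [fderiv_apply_two hG.differentiableAt_christoffel,
      fderiv_apply_two hB.differentiableAt_christoffel]
    have : (fun y => christoffel G y v w) =ᶠ[𝓝 x] fun y => christoffel B y v w + S y v w := by
      filter_upwards [h] with y hy using hy v w
    rw [this.fderiv_eq, fderiv_fun_add _ (hS v w).differentiableAt, ← (hS v w).fderiv]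
    · rfl
    · exact (hB.differentiableAt_christoffel.clm_apply (differentiableAt_const v)).clm_apply
        (differentiableAt_const w)
  have h0 := h.self_of_nhds
  rw [riemann_apply, riemann_apply, key, key, h0 v w, h0 u w, map_add, map_add, h0, h0, h0, h0]
  abel

end CoordinateTheory

/-! ### Curvature of a metric warped by block scalars. -/

section Warp

variable {E : Type*} [NormedAddCommGroup E] [NormedSpace ℝ E]

/-- `A` is self-adjoint for the form `b`, and can be moved between the three arguments of `D`.
This holds for the block scalar endomorphisms of a product metric with derivative `D`. -/
structure IsBlock (b : E →L[ℝ] E →L[ℝ] ℝ) (D : E →L[ℝ] E →L[ℝ] E →L[ℝ] ℝ) (A : E →L[ℝ] E) :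
    Prop where
  form : ∀ v w, b (A v) w = b v (A w)
  deriv_left : ∀ u v w, D (A u) v w = D u (A v) w
  deriv_right : ∀ u v w, D u (A v) w = D u v (A w)

theorem IsBlock.koszul_right {b : E →L[ℝ] E →L[ℝ] ℝ} {D : E →L[ℝ] E →L[ℝ] E →L[ℝ] ℝ}
    {A : E →L[ℝ] E} (h : IsBlock b D A) (u v w : E) : koszul D u (A v) w = koszul D u v (A w) := by
  rw [koszul_apply, koszul_apply, h.deriv_right, h.deriv_left, h.deriv_right, h.deriv_left,
    h.deriv_right]

/-- The metric `G = B(W(α) ·, ·)`, where `W` is a block scalar endomorphism depending on the linear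
function `α`, with logarithmic derivative `2 L`. The gradient of `α` is `a`. -/
structure WarpData (B G : E → E →L[ℝ] E →L[ℝ] ℝ) (x : E) (α : E →L[ℝ] ℝ) (W L : ℝ → E →L[ℝ] E)
    (L' : E →L[ℝ] E) (a : ℝ → E) (l : ℝ) : Prop where
  germ : MetricGerm B x
  germ_warped : MetricGerm G x
  eq : ∀ᶠ y in 𝓝 x, ∀ v w, G y v w = B y (W (α y) v) w
  block : ∀ᶠ y in 𝓝 x, ∀ t, IsBlock (B y) (fderiv ℝ B y) (W t) ∧ IsBlock (B y) (fderiv ℝ B y) (L t)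
  comm : ∀ t v, W t (L t v) = L t (W t v)
  deriv_weight : ∀ᶠ t in 𝓝 (α x), HasDerivAt W ((2 : ℝ) • (W t ∘L L t)) t
  deriv_log : HasDerivAt L L' (α x)
  grad : ∀ᶠ y in 𝓝 x, ∀ z, G y (a (α y)) z = α z
  deriv_grad : HasDerivAt a (-(2 * l) • a (α x)) (α x)
  log_grad : L (α x) (a (α x)) = l • a (α x)
  log_form : ∀ v, α (L (α x) v) = l * α v
  deriv_form_left : ∀ u v, fderiv ℝ B x (a (α x)) u v = 0
  deriv_form_right : ∀ u v, fderiv ℝ B x u (a (α x)) v = 0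

namespace WarpData

variable {B G : E → E →L[ℝ] E →L[ℝ] ℝ} {x : E} {α : E →L[ℝ] ℝ} {W L : ℝ → E →L[ℝ] E}
    {L' : E →L[ℝ] E} {a : ℝ → E} {l : ℝ}

/-- Product rule for `B y (W (α y) v) w`, with the derivative of the weight given by 2 W L. -/
theorem eventually_fderiv (h : WarpData B G x α W L L' a l) :
    ∀ᶠ y in 𝓝 x, ∀ u v w, fderiv ℝ G y u v w
      = fderiv ℝ B y u (W (α y) v) w + 2 * α u * G y (L (α y) v) w := by
  have hα : Tendsto α (𝓝 x) (𝓝 (α x)) := α.continuous.continuousAt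
  filter_upwards [h.eq.eventually_nhds, h.germ.eventually, h.germ_warped.eventually,
    hα.eventually h.deriv_weight] with y hy hB hG hW u v w
  rw [fderiv_apply_two hG.differentiableAt]
  have : (fun y => G y v w) =ᶠ[𝓝 y] fun y => B y (W (α y) v) w := by
    filter_upwards [hy] with z hz using hz v w
  rw [this.fderiv_eq]
  have hWv : HasFDerivAt (fun y => W (α y) v)
      (α.smulRight (((2 : ℝ) • (W (α y) ∘L L (α y))) v)) y :=
    ((hW.hasFDerivAt.comp y α.hasFDerivAt).clm_apply (hasFDerivAt_const v y)).congr_fderiv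
      (by ext u; simp)
  have := ((hB.differentiableAt.hasFDerivAt.clm_apply hWv).clm_apply (hasFDerivAt_const w y)).fderiv
  rw [this, hy.self_of_nhds]
  simp
  ring

/-- The Christoffel symbols of the warped metric. -/
theorem eventually_christoffel [FiniteDimensional ℝ E] (h : WarpData B G x α W L L' a l) :
    ∀ᶠ y in 𝓝 x, ∀ v w, christoffel G y v w = christoffel B y v w
      + (α v • L (α y) w + α w • L (α y) v - G y (L (α y) v) w • a (α y)) := by
  filter_upwards [h.eventually_fderiv, h.germ.eventually, h.germ_warped.eventually, h.eq, h.block,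
    h.grad] with y hD hB hG he hb hgr v w
  refine hG.christoffel_eq fun z => ?_
  obtain ⟨hW, hL⟩ := hb (α y)
  have h1 : G y (christoffel B y v w) z = koszul (fderiv ℝ B y) v w (W (α y) z) := by
    rw [he, hW.form, hB.apply_christoffel]
  -- `L` is self-adjoint for `G` as well as for `B`, because it commutes with `W`.
  have hs : ∀ p q, G y (L (α y) p) q = G y (L (α y) q) p := fun p q => by
    rw [he, h.comm, hL.form, ← he, hG.symm_self]
  simp only [map_add, map_sub, map_smul, _root_.add_apply,
    _root_.sub_apply, _root_.smul_apply, smul_eq_mul, h1, hgr]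
  rw [koszul_apply, koszul_apply, hD, hD, hD, hW.deriv_right v w z, hW.deriv_right w v z,
    hW.deriv_left z v w]
  ring

/-- The curvature of the warped metric. -/
theorem riemann_eq [FiniteDimensional ℝ E] (h : WarpData B G x α W L L' a l) {K : E →L[ℝ] E}
    (hK : K = L' + L (α x) ∘L L (α x) - (2 * l) • L (α x)) (u v w : E) :
    riemann G x v w u = riemann B x v w u + α w • (α u • K v - α v • K u)
      - (α u * G x (K v) w - α v * G x (K u) w) • a (α x)
      - α (a (α x)) • (G x (L (α x) v) w • L (α x) u - G x (L (α x) u) w • L (α x) v) := by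
  have hB := h.germ
  have hG := h.germ_warped
  have hD := h.eventually_fderiv.self_of_nhds
  have he := h.eq.self_of_nhds
  have hgr := h.grad.self_of_nhds
  obtain ⟨hW, hL⟩ := h.block.self_of_nhds (α x)
  have hS : ∀ v w, HasFDerivAt
      (fun y => α v • L (α y) w + α w • L (α y) v - G y (L (α y) v) w • a (α y))
      (α v • α.smulRight (L' w) + α w • α.smulRight (L' v)
        - (G x (L (α x) v) w • α.smulRight (-(2 * l) • a (α x))
          + (((fderiv ℝ G x).flip (L (α x) v)).flip w
            + α.smulRight (G x (L' v) w)).smulRight (a (α x)))) x := by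
    intro v w
    have h1 : ∀ v, HasFDerivAt (fun y => L (α y) v) (α.smulRight (L' v)) x := fun v =>
      ((h.deriv_log.hasFDerivAt.comp x α.hasFDerivAt).clm_apply
        (hasFDerivAt_const v x)).congr_fderiv (by ext u; simp)
    have h2 : HasFDerivAt (fun y => a (α y)) (α.smulRight (-(2 * l) • a (α x))) x :=
      (h.deriv_grad.hasFDerivAt.comp x α.hasFDerivAt).congr_fderiv (by ext u; simp)
    have h3 := (hG.differentiableAt.hasFDerivAt.clm_apply (h1 v)).clm_apply (hasFDerivAt_const w x)
    have h4 : HasFDerivAt (fun y => G y (L (α y) v) w)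
        (((fderiv ℝ G x).flip (L (α x) v)).flip w + α.smulRight (G x (L' v) w)) x :=
      h3.congr_fderiv (by ext u; simp [add_comm])
    exact (((h1 w).const_smul (α v)).add ((h1 v).const_smul (α w))).sub (h4.smul h2)
  have hgs := hG.symm_self
  have hsL : ∀ p q, G x (L (α x) p) q = G x p (L (α x) q) := fun p q => by
    rw [he, h.comm, hL.form, ← he]
  have hkos : ∀ p q z, G x (christoffel B x p q) z = koszul (fderiv ℝ B x) p q (W (α x) z) := by
    intro p q z
    rw [he, hW.form, hB.apply_christoffel]
  -- The next three facts say that, for the connection of `B`, the gradient, the form `α` and the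
  -- endomorphism `L` are parallel. They let all Christoffel symbols of `B` cancel outside `riemann
  -- B`.
  have hΓa : ∀ p, christoffel B x p (a (α x)) = 0 := fun p => hG.ext fun z => by
    rw [hkos, koszul_apply, h.deriv_form_left, h.deriv_form_right, hB.fderiv_symm,
      h.deriv_form_right]
    simp
  have hαΓ : ∀ p q, α (christoffel B x p q) = 0 := fun p q => by
    rw [← hgr, hgs, hkos, koszul_apply, ← hW.deriv_right, ← hW.deriv_right, hW.deriv_left,
      h.deriv_form_left]
    rw [hB.fderiv_symm, h.deriv_form_right, hB.fderiv_symm, h.deriv_form_right]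
    simp
  have hLΓ : ∀ p q, L (α x) (christoffel B x p q) = christoffel B x p (L (α x) q) :=
    fun p q => hG.ext fun z => by
      rw [hsL, hkos, hkos, hL.koszul_right, h.comm]
  have hDB : ∀ u v w, fderiv ℝ B x u (W (α x) (L (α x) v)) w
      = G x (christoffel B x u v) (L (α x) w) + G x (christoffel B x u w) (L (α x) v) := by
    intro u v w
    rw [hkos, hkos, ← koszul_add_koszul hB.fderiv_symm, h.comm, hL.koszul_right, hW.koszul_right]
  rw [riemann_of_christoffel_eq_add hG hB h.eventually_christoffel hS, hK]
  have hga : ∀ p, G x (L (α x) p) (a (α x)) = l * α p := fun p => by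
    rw [hsL, h.log_grad, map_smul, hgs, hgr, smul_eq_mul]
  have hGΓ : ∀ p q z, G x (L (α x) z) (christoffel B x p q)
      = G x (christoffel B x p q) (L (α x) z) := fun p q z => hgs _ _
  have hLL : ∀ p q, G x (L (α x) (L (α x) p)) q = G x (L (α x) p) (L (α x) q) :=
    fun p q => hsL _ _
  have hΓL : christoffel B x v (L (α x) u) = christoffel B x u (L (α x) v) := by
    rw [← hLΓ, ← hLΓ, hB.christoffel_comm]
  simp only [map_add, map_sub, map_smul, _root_.add_apply,
    _root_.sub_apply, _root_.smul_apply, smul_eq_mul,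
    ContinuousLinearMap.smulRight_apply, ContinuousLinearMap.flip_apply, hD, hDB, hΓa, hαΓ, hLΓ,
    h.log_grad, h.log_form, ContinuousLinearMap.comp_apply, hga, hGΓ, hLL]
  rw [hB.christoffel_comm v u, hΓL, hgs (L (α x) v) (L (α x) u)]
  module

/-- The Ricci tensor of the warped metric. -/
theorem ricci_eq [FiniteDimensional ℝ E] (h : WarpData B G x α W L L' a l) {K : E →L[ℝ] E} {k : ℝ}
    (hK : K = L' + L (α x) ∘L L (α x) - (2 * l) • L (α x))
    (hKa : K (a (α x)) = k • a (α x)) (hαK : ∀ v, α (K v) = k * α v) (v w : E) :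
    ricci G x v w = ricci B x v w
      + α v * α w * (2 * k - LinearMap.trace ℝ E (K : E →ₗ[ℝ] E))
      - α (a (α x)) * (G x (K v) w - G x (L (α x) (L (α x) v)) w
        + LinearMap.trace ℝ E (L (α x) : E →ₗ[ℝ] E) * G x (L (α x) v) w) := by
  -- The curvature endomorphism is written with multiples of `K` and `L` and rank-one maps, the
  -- trace of a rank-one map being an evaluation.
  have hR : (riemann G x v w : E →ₗ[ℝ] E) = (riemann B x v w : E →ₗ[ℝ] E)
      + (α w • ((α : E →ₗ[ℝ] ℝ).smulRight (K v) - α v • (K : E →ₗ[ℝ] E)))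
      - (G x (K v) w • (α : E →ₗ[ℝ] ℝ).smulRight (a (α x))
        - α v • ((G x).flip w ∘L K : E →ₗ[ℝ] ℝ).smulRight (a (α x)))
      - α (a (α x)) • (G x (L (α x) v) w • (L (α x) : E →ₗ[ℝ] E)
        - ((G x).flip w ∘L L (α x) : E →ₗ[ℝ] ℝ).smulRight (L (α x) v)) := by
    ext u
    have := h.riemann_eq hK u v w
    simp only [ContinuousLinearMap.coe_coe, LinearMap.add_apply, LinearMap.sub_apply,
      LinearMap.smul_apply, LinearMap.smulRight_apply, ContinuousLinearMap.coe_comp,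
      Function.comp_apply, ContinuousLinearMap.flip_apply] at this ⊢
    rw [this]
    module
  rw [ricci, ricci, hR]
  simp only [map_add, map_sub, map_smul, LinearMap.trace_smulRight, ContinuousLinearMap.coe_coe,
    ContinuousLinearMap.coe_comp, Function.comp_apply, ContinuousLinearMap.flip_apply, hKa, hαK,
    h.grad.self_of_nhds, smul_eq_mul]
  ring

end WarpData

end Warp

/-! ### Products of metrics. -/

section Product

variable {E : Type*} [NormedAddCommGroup E] [NormedSpace ℝ E]
  {E' : Type*} [NormedAddCommGroup E'] [NormedSpace ℝ E']

/-- The orthogonal sum of two bilinear forms. -/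
def prodForm (b : E →L[ℝ] E →L[ℝ] ℝ) (b' : E' →L[ℝ] E' →L[ℝ] ℝ) :
    E × E' →L[ℝ] E × E' →L[ℝ] ℝ :=
  pullbackForm (ContinuousLinearMap.fst ℝ E E') b + pullbackForm (ContinuousLinearMap.snd ℝ E E') b'

@[simp]
theorem prodForm_apply (b : E →L[ℝ] E →L[ℝ] ℝ) (b' : E' →L[ℝ] E' →L[ℝ] ℝ) (v w : E × E') :
    prodForm b b' v w = b v.1 w.1 + b' v.2 w.2 := rfl

/-- The product of two metrics. -/
def prodMetric (A : E → E →L[ℝ] E →L[ℝ] ℝ) (B : E' → E' →L[ℝ] E' →L[ℝ] ℝ) (p : E × E') :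
    E × E' →L[ℝ] E × E' →L[ℝ] ℝ :=
  prodForm (A p.1) (B p.2)

theorem prodMetric_apply (A : E → E →L[ℝ] E →L[ℝ] ℝ) (B : E' → E' →L[ℝ] E' →L[ℝ] ℝ)
    (p v w : E × E') : prodMetric A B p v w = A p.1 v.1 w.1 + B p.2 v.2 w.2 := rfl

theorem _root_.ContDiffWithinAt.pullbackForm {X V V' : Type*} [NormedAddCommGroup X]
    [NormedSpace ℝ X] [NormedAddCommGroup V] [NormedSpace ℝ V] [NormedAddCommGroup V']
    [NormedSpace ℝ V'] {A : V →L[ℝ] V'} {b : X → V' →L[ℝ] V' →L[ℝ] ℝ} {s : Set X} {x : X}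
    {k : WithTop ℕ∞} (hb : ContDiffWithinAt ℝ k b s x) :
    ContDiffWithinAt ℝ k (fun y => pullbackForm A (b y)) s x :=
  contDiffWithinAt_const.clm_comp (hb.clm_comp contDiffWithinAt_const)

theorem MetricGerm.prod {A : E → E →L[ℝ] E →L[ℝ] ℝ} {B : E' → E' →L[ℝ] E' →L[ℝ] ℝ} {p : E × E'}
    (hA : MetricGerm A p.1) (hB : MetricGerm B p.2) : MetricGerm (prodMetric A B) p where
  contDiffAt := by
    have h1 : ContDiffAt ℝ 2 (fun p : E × E' => A p.1) p :=
      hA.contDiffAt.comp p contDiffAt_fst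
    have h2 : ContDiffAt ℝ 2 (fun p : E × E' => B p.2) p :=
      hB.contDiffAt.comp p contDiffAt_snd
    exact (ContDiffWithinAt.pullbackForm h1).add (ContDiffWithinAt.pullbackForm h2)
  symm := by
    filter_upwards [continuousAt_fst.eventually hA.symm, continuousAt_snd.eventually hB.symm]
      with q h1 h2 v w
    rw [prodMetric_apply, prodMetric_apply, h1, h2]
  nondeg := by
    filter_upwards [continuousAt_fst.eventually hA.nondeg, continuousAt_snd.eventually hB.nondeg]
      with q h1 h2 v hv
    refine Prod.ext (h1 _ fun w => ?_) (h2 _ fun w => ?_)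
    · simpa [prodMetric_apply] using hv (w, 0)
    · simpa [prodMetric_apply] using hv (0, w)

theorem fderiv_prodMetric {A : E → E →L[ℝ] E →L[ℝ] ℝ} {B : E' → E' →L[ℝ] E' →L[ℝ] ℝ} {p : E × E'}
    (hA : MetricGerm A p.1) (hB : MetricGerm B p.2) (u v w : E × E') :
    fderiv ℝ (prodMetric A B) p u v w
      = fderiv ℝ A p.1 u.1 v.1 w.1 + fderiv ℝ B p.2 u.2 v.2 w.2 := by
  rw [fderiv_apply_two (hA.prod hB).differentiableAt]
  have h1 : HasFDerivAt (fun q : E × E' => A q.1 v.1 w.1)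
      ((((fderiv ℝ A p.1).flip v.1).flip w.1).comp (ContinuousLinearMap.fst ℝ E E')) p :=
    (((hA.differentiableAt.hasFDerivAt.comp p hasFDerivAt_fst).clm_apply
      (hasFDerivAt_const v.1 p)).clm_apply (hasFDerivAt_const w.1 p)).congr_fderiv
      (by ext u <;> simp)
  have h2 : HasFDerivAt (fun q : E × E' => B q.2 v.2 w.2)
      ((((fderiv ℝ B p.2).flip v.2).flip w.2).comp (ContinuousLinearMap.snd ℝ E E')) p :=
    (((hB.differentiableAt.hasFDerivAt.comp p hasFDerivAt_snd).clm_apply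
      (hasFDerivAt_const v.2 p)).clm_apply (hasFDerivAt_const w.2 p)).congr_fderiv
      (by ext u <;> simp)
  rw [show (fun y => prodMetric A B y v w) = fun q => A q.1 v.1 w.1 + B q.2 v.2 w.2 from rfl,
    (h1.fun_add h2).fderiv]
  simp

theorem IsBlock.prod {A : E → E →L[ℝ] E →L[ℝ] ℝ} {B : E' → E' →L[ℝ] E' →L[ℝ] ℝ} {p : E × E'}
    (hA : MetricGerm A p.1) (hB : MetricGerm B p.2) {T : E →L[ℝ] E} {T' : E' →L[ℝ] E'}
    (hT : IsBlock (A p.1) (fderiv ℝ A p.1) T) (hT' : IsBlock (B p.2) (fderiv ℝ B p.2) T') :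
    IsBlock (prodMetric A B p) (fderiv ℝ (prodMetric A B) p) (T.prodMap T') where
  form v w := by simp [prodMetric_apply, hT.form, hT'.form]
  deriv_left u v w := by simp [fderiv_prodMetric hA hB, hT.deriv_left, hT'.deriv_left]
  deriv_right u v w := by simp [fderiv_prodMetric hA hB, hT.deriv_right, hT'.deriv_right]

theorem isBlock_smul_id (b : E →L[ℝ] E →L[ℝ] ℝ) (D : E →L[ℝ] E →L[ℝ] E →L[ℝ] ℝ) (c : ℝ) :
    IsBlock b D (c • ContinuousLinearMap.id ℝ E) := by
  constructor <;> intros <;> simp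

variable [FiniteDimensional ℝ E] [FiniteDimensional ℝ E']

theorem christoffel_prodMetric {A : E → E →L[ℝ] E →L[ℝ] ℝ} {B : E' → E' →L[ℝ] E' →L[ℝ] ℝ}
    {p : E × E'} (hA : MetricGerm A p.1) (hB : MetricGerm B p.2) (v w : E × E') :
    christoffel (prodMetric A B) p v w
      = (christoffel A p.1 v.1 w.1, christoffel B p.2 v.2 w.2) :=
  (hA.prod hB).christoffel_eq fun z => by
    rw [prodMetric_apply, hA.apply_christoffel, hB.apply_christoffel, koszul_apply, koszul_apply,
      koszul_apply, fderiv_prodMetric hA hB, fderiv_prodMetric hA hB, fderiv_prodMetric hA hB]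
    ring

theorem riemann_prodMetric {A : E → E →L[ℝ] E →L[ℝ] ℝ} {B : E' → E' →L[ℝ] E' →L[ℝ] ℝ}
    {p : E × E'} (hA : MetricGerm A p.1) (hB : MetricGerm B p.2) (u v w : E × E') :
    riemann (prodMetric A B) p v w u = (riemann A p.1 v.1 w.1 u.1, riemann B p.2 v.2 w.2 u.2) := by
  have key : ∀ u v w, fderiv ℝ (christoffel (prodMetric A B)) p u v w
      = (fderiv ℝ (christoffel A) p.1 u.1 v.1 w.1, fderiv ℝ (christoffel B) p.2 u.2 v.2 w.2) := by
    intro u v w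
    have h1 : HasFDerivAt (fun q : E × E' => christoffel A q.1 v.1 w.1)
        ((((fderiv ℝ (christoffel A) p.1).flip v.1).flip w.1).comp
          (ContinuousLinearMap.fst ℝ E E')) p :=
      (((hA.differentiableAt_christoffel.hasFDerivAt.comp p hasFDerivAt_fst).clm_apply
        (hasFDerivAt_const v.1 p)).clm_apply (hasFDerivAt_const w.1 p)).congr_fderiv
        (by ext u <;> simp)
    have h2 : HasFDerivAt (fun q : E × E' => christoffel B q.2 v.2 w.2)
        ((((fderiv ℝ (christoffel B) p.2).flip v.2).flip w.2).comp
          (ContinuousLinearMap.snd ℝ E E')) p :=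
      (((hB.differentiableAt_christoffel.hasFDerivAt.comp p hasFDerivAt_snd).clm_apply
        (hasFDerivAt_const v.2 p)).clm_apply (hasFDerivAt_const w.2 p)).congr_fderiv
        (by ext u <;> simp)
    have h3 : (fun q => christoffel (prodMetric A B) q v w) =ᶠ[𝓝 p]
        fun q => (christoffel A q.1 v.1 w.1, christoffel B q.2 v.2 w.2) := by
      filter_upwards [continuousAt_fst.eventually hA.eventually,
        continuousAt_snd.eventually hB.eventually] with q hq1 hq2
      exact christoffel_prodMetric hq1 hq2 v w
    rw [fderiv_apply_two (hA.prod hB).differentiableAt_christoffel, h3.fderiv_eq,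
      (h1.prodMk h2).fderiv]
    rfl
  rw [riemann_apply, riemann_apply, riemann_apply, key, key]
  simp only [christoffel_prodMetric hA hB]
  rfl

theorem ricci_prodMetric {A : E → E →L[ℝ] E →L[ℝ] ℝ} {B : E' → E' →L[ℝ] E' →L[ℝ] ℝ}
    {p : E × E'} (hA : MetricGerm A p.1) (hB : MetricGerm B p.2) (v w : E × E') :
    ricci (prodMetric A B) p v w = ricci A p.1 v.1 w.1 + ricci B p.2 v.2 w.2 := by
  rw [ricci, ricci, ricci, ← LinearMap.trace_prodMap']
  congr 1
  exact LinearMap.ext fun u => riemann_prodMetric hA hB u v w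

end Product

/-! ### Constant metrics. -/

section Constant

variable {E : Type*} [NormedAddCommGroup E] [NormedSpace ℝ E]

theorem MetricGerm.const {b : E →L[ℝ] E →L[ℝ] ℝ} (hs : ∀ v w, b v w = b w v)
    (hn : ∀ v, (∀ w, b v w = 0) → v = 0) (x : E) : MetricGerm (fun _ : E => b) x :=
  ⟨contDiffAt_const, .of_forall fun _ => hs, .of_forall fun _ => hn⟩

theorem riemann_const (b : E →L[ℝ] E →L[ℝ] ℝ) (x u v w : E) :
    riemann (fun _ : E => b) x v w u = 0 := by
  have h : christoffel (fun _ : E => b) = 0 := by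
    ext x v w
    rw [christoffel_apply]
    have : koszul (fderiv ℝ (fun _ : E => b) x) v w = 0 := by
      ext z
      rw [koszul_apply]
      simp
    rw [this]
    simp
  rw [riemann_apply, h]
  simp

theorem ricci_const (b : E →L[ℝ] E →L[ℝ] ℝ) (x v w : E) : ricci (fun _ : E => b) x v w = 0 := by
  have : (riemann (fun _ : E => b) x v w : E →ₗ[ℝ] E) = 0 :=
    LinearMap.ext fun u => riemann_const b x u v w
  rw [ricci, this, map_zero]

end Constant

/-! ### Curvature under a conformal change. -/

section Conformal

variable {E : Type*} [NormedAddCommGroup E] [NormedSpace ℝ E] [FiniteDimensional ℝ E]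

/-- If a metric conformal to `G` is flat at `x`, the curvature of `G` at `x` is the Kulkarni-Nomizu
product of `G` with a symmetric bilinear form. -/
theorem exists_kulkarniNomizu_of_conformal {G G' : E → E →L[ℝ] E →L[ℝ] ℝ} {x : E} {f : E → ℝ}
    (hG : MetricGerm G x) (hf : ContDiffAt ℝ 2 f x)
    (h : ∀ᶠ y in 𝓝 x, G' y = Real.exp (2 * f y) • G y)
    (hflat : ∀ u v w, riemann G' x v w u = 0) :
    ∃ τ : E →L[ℝ] E →L[ℝ] ℝ, (∀ v w, τ v w = τ w v) ∧ ∀ u v w z, G x (riemann G x v w u) z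
      = τ v w * G x u z - τ u w * G x v z + G x v w * τ u z - G x u w * τ v z := by
  have hG' : MetricGerm G' x := by
    refine ⟨?_, ?_, ?_⟩
    · exact ((contDiffAt_const.mul hf).exp.smul hG.contDiffAt).congr_of_eventuallyEq h
    · filter_upwards [h, hG.symm] with y hy hs v w
      simp [hy, hs v w]
    · filter_upwards [h, hG.nondeg] with y hy hs v hv
      exact hs v fun w => by simpa [hy] using hv w
  have hD : ∀ᶠ y in 𝓝 x, ∀ u v w, fderiv ℝ G' y u v w
      = Real.exp (2 * f y) * (2 * fderiv ℝ f y u * G y v w + fderiv ℝ G y u v w) := by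
    filter_upwards [h.eventually_nhds, hG.eventually, hG'.eventually,
      hf.eventually (by simp)] with y hy h1 h2 h3 u v w
    rw [fderiv_apply_two h2.differentiableAt]
    have e : (fun y => G' y v w) =ᶠ[𝓝 y] fun y => Real.exp (2 * f y) * G y v w := by
      filter_upwards [hy] with z hz
      rw [hz]; rfl
    have d1 : HasFDerivAt (fun y => G y v w) (((fderiv ℝ G y).flip v).flip w) y :=
      ((h1.differentiableAt.hasFDerivAt.clm_apply (hasFDerivAt_const v y)).clm_apply
        (hasFDerivAt_const w y)).congr_fderiv (by ext u; simp)
    have d2 := ((h3.differentiableAt (by simp)).hasFDerivAt.const_mul 2).exp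
    rw [e.fderiv_eq, (d2.fun_mul d1).fderiv]
    simp
    ring
  set t : E → E := fun y => (G y).inverse (fderiv ℝ f y) with ht
  have hGt : ∀ᶠ y in 𝓝 x, ∀ z, G y (t y) z = fderiv ℝ f y z := by
    filter_upwards [hG.eventually] with y hy z
    rw [ht, hy.isInvertible.self_apply_inverse]
  have hdf : DifferentiableAt ℝ (fderiv ℝ f) x :=
    (hf.fderiv_right (m := 1) (by norm_num)).differentiableAt (by simp)
  have htd : DifferentiableAt ℝ t x :=
    (((hG.isInvertible.contDiffAt_map_inverse (n := 1)).differentiableAt (by simp)).comp x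
      hG.differentiableAt).clm_apply hdf
  -- The classical conformal change of connection, where `t` is the gradient of `f`.
  have hΓ : ∀ᶠ y in 𝓝 x, ∀ v w, christoffel G' y v w = christoffel G y v w
      + (fderiv ℝ f y v • w + fderiv ℝ f y w • v - G y v w • t y) := by
    filter_upwards [hD, hG.eventually, hG'.eventually, h, hGt] with y h1 h2 h3 h4 h5 v w
    refine h3.christoffel_eq fun z => ?_
    rw [koszul_apply, h1, h1, h1, h4, smul_apply, smul_apply, map_add, add_apply,
      h2.apply_christoffel, koszul_apply]
    simp only [map_add, map_sub, map_smul, add_apply, sub_apply, smul_apply, smul_eq_mul, h5]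
    ring
  set H := fderiv ℝ (fderiv ℝ f) x with hH
  set θ := fderiv ℝ f x with hθ
  set T := fderiv ℝ t x with hT
  have hHs : ∀ v w, H v w = H w v := (hf.isSymmSndFDerivAt (by simp)).eq
  have hS : ∀ v w, HasFDerivAt (fun y => fderiv ℝ f y v • w + fderiv ℝ f y w • v - G y v w • t y)
      ((H.flip v).smulRight w + (H.flip w).smulRight v
        - (G x v w • T + (((fderiv ℝ G x).flip v).flip w).smulRight (t x))) x := by
    intro v w
    have d0 : ∀ v, HasFDerivAt (fun y => fderiv ℝ f y v) (H.flip v) x := fun v =>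
      (hdf.hasFDerivAt.clm_apply (hasFDerivAt_const v x)).congr_fderiv (by ext u; simp [hH])
    have d1 : HasFDerivAt (fun y => G y v w) (((fderiv ℝ G x).flip v).flip w) x :=
      ((hG.differentiableAt.hasFDerivAt.clm_apply (hasFDerivAt_const v x)).clm_apply
        (hasFDerivAt_const w x)).congr_fderiv (by ext u; simp)
    exact (((d0 v).smul_const w).add ((d0 w).smul_const v)).sub (d1.smul htd.hasFDerivAt)
  have hDG : ∀ u v w, fderiv ℝ G x u v w
      = G x (christoffel G x u v) w + G x (christoffel G x u w) v := by
    intro u v w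
    rw [hG.apply_christoffel, hG.apply_christoffel, koszul_add_koszul hG.fderiv_symm]
  have hgt := hGt.self_of_nhds
  have hgs := hG.symm_self
  -- Obtained by differentiating G(t, z) = df(z) in two ways.
  have hTz : ∀ u z, G x (T u) z
      = H u z - θ (christoffel G x u z) - G x (christoffel G x u (t x)) z := by
    intro u z
    have e1 : HasFDerivAt (fun y => G y (t y) z) ((G x ∘L T).flip z +
        ((fderiv ℝ G x).flip (t x)).flip z) x :=
      ((hG.differentiableAt.hasFDerivAt.clm_apply htd.hasFDerivAt).clm_apply
        (hasFDerivAt_const z x)).congr_fderiv (by ext u; simp [hT])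
    have e2 : HasFDerivAt (fun y => G y (t y) z) (H.flip z) x := by
      refine HasFDerivAt.congr_of_eventuallyEq (f := fun y => fderiv ℝ f y z) ?_ ?_
      · exact (hdf.hasFDerivAt.clm_apply (hasFDerivAt_const z x)).congr_fderiv
          (by ext u; simp [hH])
      · filter_upwards [hGt] with y hy using hy z
    have e3 := congrArg (fun A => A u) (e1.unique e2)
    simp only [add_apply, ContinuousLinearMap.flip_apply, ContinuousLinearMap.comp_apply, hDG]
      at e3
    rw [← hgt, hgs (t x), ← e3]
    ring
  -- The witness is Hess f - df ⊗ df + (1/2) |df|² G, the Hessian being taken for the connection of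
  -- `G`.
  refine ⟨H - ContinuousLinearMap.compL ℝ E E ℝ θ ∘L christoffel G x - θ.smulRight θ
    + (θ (t x) / 2) • G x, ?_, ?_⟩
  · intro v w
    simp [hHs v w, hG.christoffel_comm v w, hgs v w, mul_comm]
  · intro u v w z
    have := hflat u v w
    rw [riemann_of_christoffel_eq_add hG' hG hΓ hS] at this
    have := congrArg (fun p => G x p z) this
    simp only [map_add, map_sub, map_smul, add_apply, sub_apply, smul_apply, smul_eq_mul,
      ContinuousLinearMap.smulRight_apply, ContinuousLinearMap.flip_apply,
      ContinuousLinearMap.comp_apply, ContinuousLinearMap.compL_apply, hDG, hgt, hTz,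
      map_zero, zero_apply] at this ⊢
    rw [hG.christoffel_comm v u, hHs v u] at this
    have e1 := hgs v (t x)
    have e2 := hgs u (t x)
    rw [hgt] at e1 e2
    rw [hgs v u, e1, e2, hgs v (christoffel G x u w), hgs u (christoffel G x v w)] at this
    linear_combination this

end Conformal

/-! ### Building warped metrics factor by factor. -/

section WarpConstruction

variable {E : Type*} [NormedAddCommGroup E] [NormedSpace ℝ E]
  {E' : Type*} [NormedAddCommGroup E'] [NormedSpace ℝ E']

/-- A nonvanishing function `w` near `t`, with logarithmic derivative `2 l`, where `l' = l' t`. -/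
structure IsWeight (w l : ℝ → ℝ) (l' t : ℝ) : Prop where
  contDiffAt : ContDiffAt ℝ 2 w t
  ne_zero : ∀ᶠ s in 𝓝 t, w s ≠ 0
  deriv_weight : ∀ᶠ s in 𝓝 t, HasDerivAt w (2 * w s * l s) s
  deriv_log : HasDerivAt l l' t

theorem MetricGerm.smul {B : E → E →L[ℝ] E →L[ℝ] ℝ} {x : E} (hB : MetricGerm B x) {c : E → ℝ}
    (hc : ContDiffAt ℝ 2 c x) (h0 : ∀ᶠ y in 𝓝 x, c y ≠ 0) : MetricGerm (fun y => c y • B y) x where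
  contDiffAt := hc.smul hB.contDiffAt
  symm := by
    filter_upwards [hB.symm] with y hy v w
    simp [hy v w]
  nondeg := by
    filter_upwards [hB.nondeg, h0] with y hy hc v hv
    exact hy v fun w => (mul_eq_zero.mp (hv w)).resolve_left hc

/-- A constant metric scaled by a function of `α`. -/
theorem WarpData.const {b : E →L[ℝ] E →L[ℝ] ℝ} (hs : ∀ v w, b v w = b w v)
    (hn : ∀ v, (∀ w, b v w = 0) → v = 0) {x : E} {α : E →L[ℝ] ℝ} {a : E} (ha : ∀ z, b a z = α z)
    {w l : ℝ → ℝ} {l' : ℝ} (hw : IsWeight w l l' (α x)) :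
    WarpData (fun _ => b) (fun y => w (α y) • b) x α
      (fun t => w t • ContinuousLinearMap.id ℝ E) (fun t => l t • ContinuousLinearMap.id ℝ E)
      (l' • ContinuousLinearMap.id ℝ E) (fun t => (w t)⁻¹ • a) (l (α x)) := by
  have hα : Tendsto α (𝓝 x) (𝓝 (α x)) := α.continuous.continuousAt
  constructor
  · exact .const hs hn x
  · exact (MetricGerm.const hs hn x).smul (c := fun y => w (α y))
      (hw.contDiffAt.comp x α.contDiff.contDiffAt) (hα.eventually hw.ne_zero)
  · exact .of_forall fun y v w => by simp
  · exact .of_forall fun y t => ⟨isBlock_smul_id _ _ _, isBlock_smul_id _ _ _⟩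
  · intro t v
    simp [smul_smul, mul_comm]
  · filter_upwards [hw.deriv_weight] with t ht
    refine (ht.smul_const (ContinuousLinearMap.id ℝ E)).congr_deriv ?_
    ext v
    simp only [smul_apply, ContinuousLinearMap.comp_apply, ContinuousLinearMap.id_apply]
    module
  · exact hw.deriv_log.smul_const _
  · filter_upwards [hα.eventually hw.ne_zero] with y hy z
    simp [ha, hy]
  · have h0 := hw.ne_zero.self_of_nhds
    refine ((hw.deriv_weight.self_of_nhds.inv h0).smul_const a).congr_deriv ?_
    rw [smul_smul]
    congr 1
    field_simp
  · simp only [smul_apply, ContinuousLinearMap.id_apply]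
  · simp
  · simp
  · simp

/-- The sum of a warped metric and of a metric scaled by a function of `α`. -/
theorem WarpData.prod {B G : E → E →L[ℝ] E →L[ℝ] ℝ} {x : E} {α : E →L[ℝ] ℝ} {W L : ℝ → E →L[ℝ] E}
    {L' : E →L[ℝ] E} {a : ℝ → E} {l₀ : ℝ} (h : WarpData B G x α W L L' a l₀)
    {B' : E' → E' →L[ℝ] E' →L[ℝ] ℝ} {x' : E'} (hB' : MetricGerm B' x')
    {w l : ℝ → ℝ} {l' : ℝ} (hw : IsWeight w l l' (α x)) :
    WarpData (prodMetric B B') (fun p => prodForm (G p.1) (w (α p.1) • B' p.2)) (x, x')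
      (α ∘L ContinuousLinearMap.fst ℝ E E')
      (fun t => (W t).prodMap (w t • ContinuousLinearMap.id ℝ E'))
      (fun t => (L t).prodMap (l t • ContinuousLinearMap.id ℝ E'))
      (L'.prodMap (l' • ContinuousLinearMap.id ℝ E')) (fun t => (a t, 0)) l₀ := by
  have hα : Tendsto α (𝓝 x) (𝓝 (α x)) := α.continuous.continuousAt
  have hfst : Tendsto Prod.fst (𝓝 (x, x')) (𝓝 x) := continuousAt_fst
  have hsnd : Tendsto Prod.snd (𝓝 (x, x')) (𝓝 x') := continuousAt_snd
  have hprodMap : ∀ {A : ℝ → E →L[ℝ] E} {A' : E →L[ℝ] E} {C : ℝ → E' →L[ℝ] E'} {C' : E' →L[ℝ] E'}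
      {t : ℝ}, HasDerivAt A A' t → HasDerivAt C C' t →
      HasDerivAt (fun t => (A t).prodMap (C t)) (A'.prodMap C') t := by
    intro A A' C C' t hA hC
    exact ((ContinuousLinearMap.prodMapL ℝ E E E' E').hasFDerivAt.comp_hasDerivAt t
      (hA.prodMk hC))
  have hc : ContDiffAt ℝ 2 (fun p : E × E' => w (α p.1)) (x, x') :=
    hw.contDiffAt.comp (x, x')
      (f := fun p : E × E' => α p.1) (α.contDiff.contDiffAt.comp (x, x') contDiffAt_fst)
  constructor
  · exact h.germ.prod hB'
  · refine ⟨?_, ?_, ?_⟩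
    · have h1 : ContDiffAt ℝ 2 (fun p : E × E' => G p.1) (x, x') :=
        h.germ_warped.contDiffAt.comp (x, x') contDiffAt_fst
      have h2 : ContDiffAt ℝ 2 (fun p : E × E' => B' p.2) (x, x') :=
        hB'.contDiffAt.comp (x, x') contDiffAt_snd
      exact (ContDiffWithinAt.pullbackForm h1).add (ContDiffWithinAt.pullbackForm (hc.smul h2))
    · filter_upwards [hfst.eventually h.germ_warped.symm, hsnd.eventually hB'.symm]
        with p h1 h2 v w
      simp [h1 v.1, h2 v.2]
    · filter_upwards [hfst.eventually h.germ_warped.nondeg, hsnd.eventually hB'.nondeg,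
        hfst.eventually (hα.eventually hw.ne_zero)] with p h1 h2 h3 v hv
      refine Prod.ext (h1 _ fun w => ?_) (h2 _ fun w => ?_)
      · simpa using hv (w, 0)
      · simpa [h3] using hv (0, w)
  · filter_upwards [hfst.eventually h.eq] with p hp v w
    simp [hp, prodMetric_apply]
  · filter_upwards [hfst.eventually h.block, hfst.eventually h.germ.eventually,
      hsnd.eventually hB'.eventually] with p h1 h2 h3 t
    exact ⟨(h1 t).1.prod h2 h3 (isBlock_smul_id _ _ _),
      (h1 t).2.prod h2 h3 (isBlock_smul_id _ _ _)⟩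
  · intro t v
    refine Prod.ext (h.comm t v.1) ?_
    simp [smul_smul, mul_comm]
  · filter_upwards [h.deriv_weight, hw.deriv_weight] with t h1 h2
    refine (hprodMap h1 (h2.smul_const (ContinuousLinearMap.id ℝ E'))).congr_deriv ?_
    ext v <;> simp [smul_smul, mul_assoc]
  · exact hprodMap h.deriv_log (hw.deriv_log.smul_const _)
  · filter_upwards [hfst.eventually h.grad] with p hp z
    simp [hp]
  · refine (h.deriv_grad.prodMk (hasDerivAt_const _ (0 : E'))).congr_deriv ?_
    simp
  · simp [h.log_grad]
  · intro v
    simp [h.log_form]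
  · intro u v
    simp [fderiv_prodMetric (p := (x, x')) h.germ hB', h.deriv_form_left]
  · intro u v
    simp [fderiv_prodMetric (p := (x, x')) h.germ hB', h.deriv_form_right]

end WarpConstruction

/-! ### Ricci tensor of the total metric. -/

section DoublyWarped

variable {E₀ E₁ E₂ : Type*} [NormedAddCommGroup E₀] [NormedSpace ℝ E₀] [NormedAddCommGroup E₁]
  [NormedSpace ℝ E₁] [NormedAddCommGroup E₂] [NormedSpace ℝ E₂] [FiniteDimensional ℝ E₀]
  [FiniteDimensional ℝ E₁] [FiniteDimensional ℝ E₂]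

/-- The Ricci tensor of the metric `w₀ b ⊕ w₁ B₁ ⊕ w₂ B₂`, where `b` is constant, `B₁` and `B₂` are
Ricci-flat, and `w₀`, `w₁`, `w₂` are functions of the linear form `α`. -/
theorem ricci_doublyWarped {b : E₀ →L[ℝ] E₀ →L[ℝ] ℝ} (hs : ∀ v w, b v w = b w v)
    (hn : ∀ v, (∀ w, b v w = 0) → v = 0) {α : E₀ →L[ℝ] ℝ} {a : E₀} (ha : ∀ z, b a z = α z)
    {B₁ : E₁ → E₁ →L[ℝ] E₁ →L[ℝ] ℝ} {B₂ : E₂ → E₂ →L[ℝ] E₂ →L[ℝ] ℝ} {x : E₀} {x₁ : E₁} {x₂ : E₂}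
    (hB₁ : MetricGerm B₁ x₁) (hB₂ : MetricGerm B₂ x₂) (hR₁ : ∀ v w, ricci B₁ x₁ v w = 0)
    (hR₂ : ∀ v w, ricci B₂ x₂ v w = 0) {w₀ w₁ w₂ l₀ l₁ l₂ : ℝ → ℝ} {l₀' l₁' l₂' : ℝ}
    (h₀ : IsWeight w₀ l₀ l₀' (α x)) (h₁ : IsWeight w₁ l₁ l₁' (α x)) (h₂ : IsWeight w₂ l₂ l₂' (α x))
    {tr : ℝ} (htr : tr = Module.finrank ℝ E₀ * l₀ (α x) + Module.finrank ℝ E₁ * l₁ (α x)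
      + Module.finrank ℝ E₂ * l₂ (α x))
    (hb : ((Module.finrank ℝ E₀ : ℝ) - 2) * (l₀' + l₀ (α x) ^ 2 - 2 * l₀ (α x) * l₀ (α x))
      + Module.finrank ℝ E₁ * (l₁' + l₁ (α x) ^ 2 - 2 * l₀ (α x) * l₁ (α x))
      + Module.finrank ℝ E₂ * (l₂' + l₂ (α x) ^ 2 - 2 * l₀ (α x) * l₂ (α x)) = 0)
    (hη : α a = 0 ∨ (l₀' = (2 * l₀ (α x) - tr) * l₀ (α x) ∧ l₁' = (2 * l₀ (α x) - tr) * l₁ (α x)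
      ∧ l₂' = (2 * l₀ (α x) - tr) * l₂ (α x))) (v w : (E₀ × E₁) × E₂) :
    ricci (fun p : (E₀ × E₁) × E₂ =>
      prodForm (prodForm (w₀ (α p.1.1) • b) (w₁ (α p.1.1) • B₁ p.1.2)) (w₂ (α p.1.1) • B₂ p.2))
      ((x, x₁), x₂) v w = 0 := by
  have H := ((WarpData.const hs hn ha h₀).prod hB₁ h₁).prod hB₂
    (h₂ : IsWeight w₂ l₂ l₂' ((α ∘L ContinuousLinearMap.fst ℝ E₀ E₁) (x, x₁)))
  have hα0 : ((α ∘L ContinuousLinearMap.fst ℝ E₀ E₁) ∘L ContinuousLinearMap.fst ℝ (E₀ × E₁) E₂)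
    ((x, x₁), x₂) = α x := rfl
  have hg₀ := MetricGerm.const hs hn x
  set k₀ := l₀' + l₀ (α x) ^ 2 - 2 * l₀ (α x) * l₀ (α x) with hk₀
  set k₁ := l₁' + l₁ (α x) ^ 2 - 2 * l₀ (α x) * l₁ (α x) with hk₁
  set k₂ := l₂' + l₂ (α x) ^ 2 - 2 * l₀ (α x) * l₂ (α x) with hk₂
  have hRic := H.ricci_eq (K := ((k₀ • ContinuousLinearMap.id ℝ E₀).prodMap
    (k₁ • ContinuousLinearMap.id ℝ E₁)).prodMap (k₂ • ContinuousLinearMap.id ℝ E₂)) (k := k₀)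
    (by
      rw [hα0]
      refine ContinuousLinearMap.ext fun v => ?_
      refine Prod.ext (Prod.ext ?_ ?_) ?_ <;> simp [hk₀, hk₁, hk₂] <;> module)
    (by simp) (fun v => by simp) v w
  rw [ricci_prodMetric (hg₀.prod hB₁) hB₂, ricci_prodMetric hg₀ hB₁, ricci_const, hR₁, hR₂, hα0]
    at hRic
  refine hRic.trans ?_
  have htrace : ∀ c₀ c₁ c₂ : ℝ, LinearMap.trace ℝ ((E₀ × E₁) × E₂)
      (((c₀ • ContinuousLinearMap.id ℝ E₀).prodMap (c₁ • ContinuousLinearMap.id ℝ E₁)).prodMap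
        (c₂ • ContinuousLinearMap.id ℝ E₂) : (E₀ × E₁) × E₂ →ₗ[ℝ] (E₀ × E₁) × E₂)
      = Module.finrank ℝ E₀ * c₀ + Module.finrank ℝ E₁ * c₁ + Module.finrank ℝ E₂ * c₂ := by
    intro c₀ c₁ c₂
    simp only [ContinuousLinearMap.coe_prodMap, LinearMap.trace_prodMap',
      ContinuousLinearMap.toLinearMap_smul, ContinuousLinearMap.coe_id, map_smul, LinearMap.trace_id,
      smul_eq_mul]
    ring
  rw [htrace, htrace, ← htr]
  -- This is the coefficient of α ⊗ α; `hb` is its vanishing.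
  have e : 2 * k₀ - (Module.finrank ℝ E₀ * k₀ + Module.finrank ℝ E₁ * k₁
    + Module.finrank ℝ E₂ * k₂) = 0 := by linarith
  rw [e]
  rcases hη with hη | ⟨e₀, e₁, e₂⟩
  · simp [hη]
  -- What remains contains K - L² + tr(L) L = L' - (2 l₀ - tr) L, which the system kills block by
  -- block.
  · rw [mul_zero, add_zero, add_zero, add_zero, zero_sub, neg_eq_zero]
    refine mul_eq_zero_of_right _ ?_
    simp [hk₀, hk₁, hk₂, e₀, e₁, e₂]
    ring

end DoublyWarped

/-! ### Obstructions to conformal flatness. -/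

section NotConformallyFlat

/-- In dimension at least 3 the Kulkarni-Nomizu product with a nondegenerate form is injective. A
third index k isolates each off-diagonal entry of τ; for the diagonal, the relations for the three
pairs among i, j, k form an invertible linear system. -/
theorem eq_zero_of_kulkarniNomizu_eq_zero {E : Type*} [NormedAddCommGroup E] [NormedSpace ℝ E]
    {b τ : E →L[ℝ] E →L[ℝ] ℝ} {n : ℕ} (hn : 3 ≤ n) (e : Module.Basis (Fin n) ℝ E) {ε : Fin n → ℝ}
    (hε : ∀ i, ε i ≠ 0) (he : ∀ i j, b (e i) (e j) = if i = j then ε i else 0)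
    (h : ∀ u v w z, τ v w * b u z - τ u w * b v z + b v w * τ u z - b u w * τ v z = 0) (v w : E) :
    τ v w = 0 := by
  have hoff : ∀ i j, i ≠ j → τ (e i) (e j) = 0 := by
    intro i j hij
    obtain ⟨k, hk⟩ : ∃ k, k ∉ ({i, j} : Finset (Fin n)) := by
      by_contra! hk
      have := Finset.card_le_card (Finset.subset_iff.mpr fun k _ => hk k :
        (Finset.univ : Finset (Fin n)) ⊆ {i, j})
      have := Finset.card_le_two (a := i) (b := j)
      simp at *
      omega
    simp only [Finset.mem_insert, Finset.mem_singleton, not_or] at hk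
    have := h (e i) (e k) (e k) (e j)
    simp only [he, if_neg hij, if_neg hk.2, if_neg (Ne.symm hk.1), if_true] at this
    simpa [hε k] using this
  have hpair : ∀ i k, i ≠ k → τ (e k) (e k) * ε i + ε k * τ (e i) (e i) = 0 := by
    intro i k hik
    have := h (e i) (e k) (e k) (e i)
    simp only [he, if_neg hik, if_neg (Ne.symm hik), if_true] at this
    linarith
  have hdiag : ∀ i, τ (e i) (e i) = 0 := by
    intro i
    obtain ⟨j, hj⟩ : ∃ j, j ∉ ({i} : Finset (Fin n)) := by
      by_contra! hk
      have := Finset.card_le_card (Finset.subset_iff.mpr fun k _ => hk k :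
        (Finset.univ : Finset (Fin n)) ⊆ {i})
      simp at this
      omega
    obtain ⟨k, hk⟩ : ∃ k, k ∉ ({i, j} : Finset (Fin n)) := by
      by_contra! hk
      have := Finset.card_le_card (Finset.subset_iff.mpr fun k _ => hk k :
        (Finset.univ : Finset (Fin n)) ⊆ {i, j})
      have := Finset.card_le_two (a := i) (b := j)
      simp at *
      omega
    simp only [Finset.mem_insert, Finset.mem_singleton, not_or] at hj hk
    have h1 := hpair i j (Ne.symm hj)
    have h2 := hpair i k (Ne.symm hk.1)
    have h3 := hpair j k (Ne.symm hk.2)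
    have : 2 * ε j * ε k * τ (e i) (e i) = 0 := by
      linear_combination ε k * h1 + ε j * h2 - ε i * h3
    simpa [hε] using this
  have : (τ : E →ₗ[ℝ] E →L[ℝ] ℝ) = 0 := e.ext fun i => by
    have : (τ (e i) : E →ₗ[ℝ] ℝ) = 0 := e.ext fun j => by
      by_cases hij : i = j
      · subst hij; simpa using hdiag i
      · simpa using hoff i j hij
    ext z
    exact congrArg (fun f => f z) this
  have := congrArg (fun f => f v w) this
  simpa using this

/-- The trivial weight: after a conformal change the flat factor of the base is not scaled at all.
-/
theorem isWeight_one (t : ℝ) : IsWeight (fun _ => 1) (fun _ => 0) 0 t :=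
  ⟨contDiffAt_const, by simp, .of_forall fun s => by simpa using hasDerivAt_const s (1 : ℝ),
    hasDerivAt_const _ _⟩

/-- If the metric `b ⊕ w B`, with `b` constant and `w` a function of the linear form `α`, is
conformally flat at a point, then `√w` is affine and `B` has constant curvature at that point. -/
theorem warped_of_conformally_flat {E₀ E₁ : Type*} [NormedAddCommGroup E₀] [NormedSpace ℝ E₀]
    [NormedAddCommGroup E₁] [NormedSpace ℝ E₁] [FiniteDimensional ℝ E₀] [FiniteDimensional ℝ E₁]
    {b : E₀ →L[ℝ] E₀ →L[ℝ] ℝ} {n : ℕ} (hn : 3 ≤ n) (e : Module.Basis (Fin n) ℝ E₀) {ε : Fin n → ℝ}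
    (hε : ∀ i, ε i ≠ 0) (he : ∀ i j, b (e i) (e j) = if i = j then ε i else 0)
    (hs : ∀ v w, b v w = b w v) (hnd : ∀ v, (∀ w, b v w = 0) → v = 0) {α : E₀ →L[ℝ] ℝ} (hα : α ≠ 0)
    {a : E₀} (ha : ∀ z, b a z = α z) {B : E₁ → E₁ →L[ℝ] E₁ →L[ℝ] ℝ} {x : E₀} {x₁ : E₁}
    (hB : MetricGerm B x₁) [Nontrivial E₁] {w l : ℝ → ℝ} {l' : ℝ} (hw : IsWeight w l l' (α x))
    {f : E₀ × E₁ → ℝ} (hf : ContDiffAt ℝ 2 f (x, x₁)) {G : E₀ × E₁ → E₀ × E₁ →L[ℝ] E₀ × E₁ →L[ℝ] ℝ}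
    (hG : ∀ᶠ p in 𝓝 (x, x₁), G p = Real.exp (2 * f p) • prodForm b (w (α p.1) • B p.2))
    (hflat : ∀ u v w, riemann G (x, x₁) v w u = 0) :
    l' + l (α x) ^ 2 = 0 ∧ ∀ u v z, riemann B x₁ v z u
      = (α a * w (α x) * l (α x) ^ 2) • (B x₁ v z • u - B x₁ u z • v) := by
  have H := (WarpData.const hs hnd ha (isWeight_one (α x))).prod hB hw
  have hone : ∀ p : E₀ × E₁, prodForm ((fun _ => (1 : ℝ)) (α p.1) • b) (w (α p.1) • B p.2)
      = prodForm b (w (α p.1) • B p.2) := fun p => by rw [one_smul]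
  obtain ⟨τ, -, hτ⟩ := exists_kulkarniNomizu_of_conformal (G' := G) H.germ_warped hf
    (by filter_upwards [hG] with p hp; rw [hp, hone]) hflat
  have hw0 := hw.ne_zero.self_of_nhds
  set k := l' + l (α x) ^ 2 with hk
  have hR := H.riemann_eq (K := (0 : E₀ →L[ℝ] E₀).prodMap (k • ContinuousLinearMap.id ℝ E₁))
    (by
      refine ContinuousLinearMap.ext fun v => ?_
      refine Prod.ext ?_ ?_ <;> simp [hk]; module)
  simp only [hR, riemann_prodMetric (p := (x, x₁)) (MetricGerm.const hs hnd x) hB, riemann_const]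
    at hτ
  simp only [one_smul, prodForm_apply] at hτ
  -- On the flat factor all curvature terms vanish, since l₀ = 0 and `b` is constant.
  have hbase : ∀ u v, τ (u, 0) (v, 0) = 0 := by
    have := eq_zero_of_kulkarniNomizu_eq_zero hn e hε he
      (τ := (pullbackForm (ContinuousLinearMap.inl ℝ E₀ E₁) τ)) (by
        intro u v w z
        have := hτ (u, 0) (v, 0) (w, 0) (z, 0)
        simpa [pullbackForm_apply] using this.symm)
    exact this
  -- The block with two base and two fibre directions: the left side is nondegenerate in `u`, `v`
  -- unless τ vanishes, while the right side has rank at most one. As n > 1, a vector in the kernel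
  -- of `α` separates the two.
  have hmix : ∀ u v p q, τ (0, p) (0, q) * b u v = - (k * α u * α v * (w (α x) * B x₁ p q)) := by
    intro u v p q
    have := hτ (u, 0) (0, p) (0, q) (v, 0)
    simp [hbase, ha] at this
    linear_combination -this
  have hker : ∃ y : E₀, y ≠ 0 ∧ α y = 0 := by
    by_contra! hinj
    have h1 : Function.Injective (α : E₀ →ₗ[ℝ] ℝ) := by
      rw [← LinearMap.ker_eq_bot, LinearMap.ker_eq_bot']
      intro y hy
      by_contra h0
      exact hinj y h0 hy
    have h2 := LinearMap.finrank_le_finrank_of_injective h1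
    rw [Module.finrank_eq_card_basis e] at h2
    simp at h2
    omega
  have hfib : ∀ p q, τ (0, p) (0, q) = 0 := by
    intro p q
    obtain ⟨y, hy0, hy⟩ := hker
    by_contra h0
    refine hy0 (hnd y fun u => ?_)
    have := hmix y u p q
    rw [hy] at this
    simpa [h0] using this
  have hkw : k = 0 := by
    obtain ⟨p, hp⟩ := exists_ne (0 : E₁)
    have : ∃ q, B x₁ p q ≠ 0 := by
      by_contra! h0
      exact hp (hB.nondeg_self h0)
    obtain ⟨q, hq⟩ := this
    obtain ⟨u, hu⟩ : ∃ u, α u ≠ 0 := by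
      by_contra! h0
      exact hα (ContinuousLinearMap.ext h0)
    have := hmix u u p q
    rw [hfib] at this
    simpa [hu, hq, hw0] using this
  refine ⟨hkw, fun u v z => hB.ext fun y => ?_⟩
  have := hτ (0, u) (0, v) (0, z) (0, y)
  simp [hfib, hw0] at this
  simp
  linear_combination this

/-- A Ricci-flat metric of constant nonzero curvature lives in dimension one. -/
theorem finrank_eq_one_of_riemann_eq {E : Type*} [NormedAddCommGroup E] [NormedSpace ℝ E]
    [FiniteDimensional ℝ E] [Nontrivial E] {B : E → E →L[ℝ] E →L[ℝ] ℝ} {x : E} (hB : MetricGerm B x)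
    (hR : ∀ v w, ricci B x v w = 0) {c : ℝ} (hc : c ≠ 0)
    (h : ∀ u v z, riemann B x v z u = c • (B x v z • u - B x u z • v)) :
    Module.finrank ℝ E = 1 := by
  obtain ⟨p, hp⟩ := exists_ne (0 : E)
  have : ∃ q, B x p q ≠ 0 := by
    by_contra! h0
    exact hp (hB.nondeg_self h0)
  obtain ⟨q, hq⟩ := this
  have e : (riemann B x p q : E →ₗ[ℝ] E) = c • (B x p q • LinearMap.id
      - ((B x).flip q : E →ₗ[ℝ] ℝ).smulRight p) := by
    ext u
    simp [h]
  have := hR p q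
  rw [ricci, e] at this
  simp [LinearMap.trace_smulRight, hc] at this
  -- A metric of constant curvature c has Ricci tensor c (dim - 1) times the metric.
  have : B x p q * ((Module.finrank ℝ E : ℝ) - 1) = 0 := by linear_combination this
  have := (mul_eq_zero.mp this).resolve_left hq
  exact_mod_cast sub_eq_zero.mp this

end NotConformallyFlat

/-! ### Index of sums and positive multiples of quadratic forms. -/

section Index

open QuadraticMap QuadraticForm

/-- Diagonalise both forms: the index counts negative weights, and the weights of the sum are the
disjoint union. -/
theorem sigNeg_prod {V V' : Type*} [AddCommGroup V] [Module ℝ V] [FiniteDimensional ℝ V]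
    [AddCommGroup V'] [Module ℝ V'] [FiniteDimensional ℝ V'] (Q : QuadraticForm ℝ V)
    (Q' : QuadraticForm ℝ V') :
    sigNeg (QuadraticMap.prod Q Q') = sigNeg Q + sigNeg Q' := by
  obtain ⟨w, ⟨e⟩⟩ := QuadraticForm.equivalent_weightedSumSquares Q
  obtain ⟨w', ⟨e'⟩⟩ := QuadraticForm.equivalent_weightedSumSquares Q'
  have h : QuadraticMap.Equivalent (QuadraticMap.prod Q Q')
      (weightedSumSquares ℝ (Sum.elim w w')) := by
    refine ⟨(QuadraticMap.IsometryEquiv.prod e e').trans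
      ⟨(LinearEquiv.sumArrowLequivProdArrow _ _ ℝ ℝ).symm, fun m => ?_⟩⟩
    obtain ⟨m₁, m₂⟩ := m
    simp [weightedSumSquares_apply, Fintype.sum_sum_type]
  rw [sigNeg_of_equiv_weightedSumSquares h, sigNeg_of_equiv_weightedSumSquares ⟨e⟩,
    sigNeg_of_equiv_weightedSumSquares ⟨e'⟩]
  have : {i | Sum.elim w w' i < 0} = Sum.inl '' {i | w i < 0} ∪ Sum.inr '' {i | w' i < 0} := by
    ext (i | i) <;> simp
  rw [this, Set.ncard_union_eq, Set.ncard_image_of_injective _ Sum.inl_injective,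
    Set.ncard_image_of_injective _ Sum.inr_injective]
  rw [Set.disjoint_left]
  rintro _ ⟨i, -, rfl⟩ ⟨j, -, hj⟩
  simp at hj

/-- Scaling vectors by √c is an isometry from `c • Q` to `Q`. -/
theorem sigNeg_smul {V : Type*} [AddCommGroup V] [Module ℝ V] (Q : QuadraticForm ℝ V)
    {c : ℝ} (hc : 0 < c) : sigNeg (c • Q) = sigNeg Q := by
  refine QuadraticMap.Equivalent.sigNeg_eq ⟨⟨LinearEquiv.smulOfNeZero ℝ V (√c)
    (Real.sqrt_pos.mpr hc).ne', fun m => ?_⟩⟩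
  have : Q (√c • m) = c * Q m := by
    rw [QuadraticMap.map_smul, smul_eq_mul, Real.mul_self_sqrt hc.le]
  exact this

end Index

/-! ### Warped products of manifolds read in charts. -/

section ManifoldLayer

variable {E : Type*} [NormedAddCommGroup E] [NormedSpace ℝ E]
  {H : Type*} [TopologicalSpace H] {I : ModelWithCorners ℝ E H}
  {M : Type*} [TopologicalSpace M] [ChartedSpace H M]
  {E' : Type*} [NormedAddCommGroup E'] [NormedSpace ℝ E']
  {H' : Type*} [TopologicalSpace H'] {I' : ModelWithCorners ℝ E' H'}
  {F : Type*} [TopologicalSpace F] [ChartedSpace H' F]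

theorem warpedProduct_apply (gB : BilinField I M) (f : M → ℝ) (gF : BilinField I' F) (p : M × F)
    (v w : TangentSpace (I.prod I') p) :
    warpedProduct gB f gF p v w = gB p.1 v.1 w.1 + f p.1 ^ 2 * gF p.2 v.2 w.2 := by
  rw [warpedProduct, mfderiv_fst, mfderiv_snd]
  rfl

theorem mdifferentiableAt_extChartAt_symm [I.Boundaryless] [IsManifold I 1 M] {p : M} {x : E}
    (hx : x ∈ (extChartAt I p).target) :
    MDifferentiableAt 𝓘(ℝ, E) I (extChartAt I p).symm x := by
  have := mdifferentiableWithinAt_extChartAt_symm hx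
  rwa [I.range_eq_univ, mdifferentiableWithinAt_univ] at this

theorem isInvertible_mfderiv_extChartAt_symm [I.Boundaryless] [IsManifold I 1 M] {p : M} {x : E}
    (hx : x ∈ (extChartAt I p).target) :
    (mfderiv 𝓘(ℝ, E) I (extChartAt I p).symm x).IsInvertible := by
  have := isInvertible_mfderivWithin_extChartAt_symm hx
  rwa [I.range_eq_univ, mfderivWithin_univ] at this

theorem coordMetric_smul (g : BilinField I M) (μ : M → ℝ) (p : M) (x : E) :
    coordMetric (fun q => μ q • g q) p x = μ ((extChartAt I p).symm x) • coordMetric g p x := rfl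

/-- The chart of a product is the product of the charts, so the derivative of its inverse is block
diagonal. -/
theorem coordMetric_warpedProduct [I.Boundaryless] [I'.Boundaryless] [IsManifold I 1 M]
    [IsManifold I' 1 F] (gB : BilinField I M) (f : M → ℝ) (gF : BilinField I' F) (p : M × F)
    {x : E × E'} (hx : x ∈ (extChartAt (I.prod I') p).target) :
    coordMetric (warpedProduct gB f gF) p x = prodForm (coordMetric gB p.1 x.1)
      (f ((extChartAt I p.1).symm x.1) ^ 2 • coordMetric gF p.2 x.2) := by
  rw [extChartAt_prod] at hx
  have hd : mfderiv 𝓘(ℝ, E × E') (I.prod I') (extChartAt (I.prod I') p).symm x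
      = (mfderiv 𝓘(ℝ, E) I (extChartAt I p.1).symm x.1).prodMap
        (mfderiv 𝓘(ℝ, E') I' (extChartAt I' p.2).symm x.2) := by
    rw [extChartAt_prod, modelWithCornersSelf_prod, ← chartedSpaceSelf_prod]
    exact mfderiv_prodMap (mdifferentiableAt_extChartAt_symm hx.1)
      (mdifferentiableAt_extChartAt_symm hx.2)
  have hv : ∀ v : E × E', mfderiv 𝓘(ℝ, E × E') (I.prod I') (extChartAt (I.prod I') p).symm x v
      = ((mfderiv 𝓘(ℝ, E) I (extChartAt I p.1).symm x.1 v.1 : E),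
        (mfderiv 𝓘(ℝ, E') I' (extChartAt I' p.2).symm x.2 v.2 : E')) :=
    fun v => congrArg (fun A => A v) hd
  refine ContinuousLinearMap.ext fun v => ContinuousLinearMap.ext fun w => ?_
  refine (warpedProduct_apply gB f gF ((extChartAt (I.prod I') p).symm x) _ _).trans ?_
  exact congrArg₂ (fun a b : E × E' => gB ((extChartAt I p.1).symm x.1) a.1 b.1
    + f ((extChartAt I p.1).symm x.1) ^ 2 * gF ((extChartAt I' p.2).symm x.2) a.2 b.2)
    (hv v) (hv w)

theorem MetricGerm.coordMetric [I.Boundaryless] [IsManifold I 1 M] {g : BilinField I M}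
    (hg : IsSemiRiemannianMetric g) (p : M) {x : E} (hx : x ∈ (extChartAt I p).target) :
    MetricGerm (coordMetric g p) x where
  contDiffAt := ((hg.contDiffOn p).contDiffAt
    ((isOpen_extChartAt_target p).mem_nhds hx)).of_le (by norm_cast)
  symm := .of_forall fun y v w => hg.symm _ _ _
  nondeg := by
    filter_upwards [(isOpen_extChartAt_target p).mem_nhds hx] with y hy v hv
    have hinv := isInvertible_mfderiv_extChartAt_symm hy
    have : mfderiv 𝓘(ℝ, E) I (extChartAt I p).symm y v = 0 :=
      hg.nondegenerate _ _ fun w => by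
        obtain ⟨w, rfl⟩ := hinv.surjective w
        exact hv w
    exact hinv.injective (this.trans (map_zero _).symm)

theorem IsSemiRiemannianMetric.warpedProduct [FiniteDimensional ℝ E] [FiniteDimensional ℝ E']
    [I.Boundaryless] [I'.Boundaryless] [IsManifold I 1 M]
    [IsManifold I' 1 F] {gB : BilinField I M} (hB : IsSemiRiemannianMetric gB) {f : M → ℝ}
    (hf : ∀ p, ContDiffOn ℝ ∞ (fun x => f ((extChartAt I p).symm x)) (extChartAt I p).target)
    (hpos : ∀ p, 0 < f p) {gF : BilinField I' F} (hF : IsSemiRiemannianMetric gF) :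
    IsSemiRiemannianMetric (warpedProduct gB f gF) where
  contDiffOn p := by
    refine ContDiffOn.congr ?_ fun x hx => coordMetric_warpedProduct gB f gF p hx
    rw [extChartAt_prod]
    intro x hx
    have h1 : ContDiffWithinAt ℝ ∞ (fun x : E × E' => coordMetric gB p.1 x.1)
        ((extChartAt I p.1).prod (extChartAt I' p.2)).target x :=
      ((hB.contDiffOn p.1) x.1 hx.1).comp x contDiffWithinAt_fst fun y hy => hy.1
    have h2 : ContDiffWithinAt ℝ ∞ (fun x : E × E' => coordMetric gF p.2 x.2)
        ((extChartAt I p.1).prod (extChartAt I' p.2)).target x :=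
      ((hF.contDiffOn p.2) x.2 hx.2).comp x contDiffWithinAt_snd fun y hy => hy.2
    have h3 : ContDiffWithinAt ℝ ∞ (fun x : E × E' => f ((extChartAt I p.1).symm x.1))
        ((extChartAt I p.1).prod (extChartAt I' p.2)).target x :=
      ((hf p.1) x.1 hx.1).comp x contDiffWithinAt_fst fun y hy => hy.1
    exact h1.pullbackForm.add ((h3.pow 2).smul h2).pullbackForm
  symm p v w := (warpedProduct_apply gB f gF p v w).trans
    ((congrArg₂ (fun a b => a + f p.1 ^ 2 * b) (hB.symm _ _ _) (hF.symm _ _ _)).trans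
      (warpedProduct_apply gB f gF p w v).symm)
  nondegenerate p v hv := by
    have h1 : ∀ (w : E) (w' : E'), gB p.1 (v : E × E').1 w
        + f p.1 ^ 2 * gF p.2 (v : E × E').2 w' = 0 := fun w w' =>
      (warpedProduct_apply gB f gF p v (w, w')).symm.trans (hv _)
    have h2 : (v : E × E').1 = 0 := hB.nondegenerate _ _ fun w => by
      have h3 : gF p.2 (v : E × E').2 (0 : E') = 0 := map_zero _
      have := h1 w 0
      rw [h3] at this
      linarith
    have h3 : (v : E × E').2 = 0 := hF.nondegenerate _ _ fun w => by
      have h3 : gB p.1 (v : E × E').1 (0 : E) = 0 := map_zero _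
      have := h1 0 w
      rw [h3, zero_add] at this
      exact (mul_eq_zero.mp this).resolve_left (pow_pos (hpos p.1) 2).ne'
    exact Prod.ext h2 h3
  constant_index := by
    obtain ⟨ν, hν⟩ := hB.constant_index
    obtain ⟨ν', hν'⟩ := hF.constant_index
    refine ⟨ν + ν', fun p => ?_⟩
    rw [← hν p.1, ← hν' p.2, ← sigNeg_smul (LinearMap.BilinMap.toQuadraticMap (gF p.2).toLinearMap₁₂) (pow_pos (hpos p.1) 2)]
    have : FiniteDimensional ℝ (TangentSpace I p.1) := ‹FiniteDimensional ℝ E›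
    have : FiniteDimensional ℝ (TangentSpace I' p.2) := ‹FiniteDimensional ℝ E'›
    refine Eq.trans ?_ (sigNeg_prod _ _)
    congr 1
    ext v
    exact warpedProduct_apply gB f gF p v v

end ManifoldLayer

/-! ### The conformal metric on an open subset of ℝⁿ. -/

section OpenSubset

variable {n : ℕ} {U : TopologicalSpace.Opens (EuclideanSpace ℝ (Fin n))}

/-- Charts of `U` are restrictions of the identity chart of ℝⁿ, so chart coordinates on `U` are the
ambient ones. -/
theorem extChartAt_symm_opens_val (p : U) {x : EuclideanSpace ℝ (Fin n)}
    (hx : x ∈ (extChartAt (𝓡 n) p).target) : ((extChartAt (𝓡 n) p).symm x : U).1 = x := by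
  have hx' : x ∈ ((chartAt (EuclideanSpace ℝ (Fin n)) p.1).subtypeRestr ⟨p⟩).target := by
    simpa [extChartAt, TopologicalSpace.Opens.chartAt_eq] using hx
  exact (chartAt (EuclideanSpace ℝ (Fin n)) p.1).subtypeRestr_symm_apply ⟨p⟩ hx'

theorem hasMFDerivAt_opens_val (p : U) :
    HasMFDerivAt (𝓡 n) (𝓡 n) (Subtype.val : U → EuclideanSpace ℝ (Fin n)) p
      (ContinuousLinearMap.id ℝ (EuclideanSpace ℝ (Fin n))) := by
  have h : HasFDerivAt (writtenInExtChartAt (𝓡 n) (𝓡 n) p Subtype.val)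
      (ContinuousLinearMap.id ℝ (EuclideanSpace ℝ (Fin n))) (extChartAt (𝓡 n) p p) := by
    refine (hasFDerivAt_id _).congr_of_eventuallyEq ?_
    filter_upwards [extChartAt_target_mem_nhds p] with x hx
    exact extChartAt_symm_opens_val p hx
  exact ⟨continuous_subtype_val.continuousAt, h.hasFDerivWithinAt⟩

theorem conformalMetric_apply (ε α : Fin n → ℝ) (φ : ℝ → ℝ) (p : U)
    (v w : EuclideanSpace ℝ (Fin n)) :
    conformalMetric ε α φ U p v w = 1 / φ (xi α p) ^ 2 * pseudoEuclidean ε v w := by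
  rw [conformalMetric, (hasMFDerivAt_opens_val p).mfderiv]
  rfl

theorem coordMetric_conformalMetric (ε α : Fin n → ℝ) (φ : ℝ → ℝ) (p : U)
    {x : EuclideanSpace ℝ (Fin n)} (hx : x ∈ (extChartAt (𝓡 n) p).target) :
    coordMetric (conformalMetric ε α φ U) p x = (1 / φ (xi α x) ^ 2) • pseudoEuclidean ε := by
  have hd : mfderiv (𝓡 n) (𝓡 n) (extChartAt (𝓡 n) p).symm x
      = ContinuousLinearMap.id ℝ (EuclideanSpace ℝ (Fin n)) := by
    have h1 := (hasMFDerivAt_opens_val ((extChartAt (𝓡 n) p).symm x)).comp x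
      (mdifferentiableAt_extChartAt_symm hx).hasMFDerivAt
    have h2 : HasMFDerivAt (𝓡 n) (𝓡 n) (Subtype.val ∘ (extChartAt (𝓡 n) p).symm) x
      (ContinuousLinearMap.id ℝ (EuclideanSpace ℝ (Fin n))) := by
      refine (hasMFDerivAt_id x).congr_of_eventuallyEq ?_
      filter_upwards [(isOpen_extChartAt_target p).mem_nhds hx] with y hy
      exact extChartAt_symm_opens_val p hy
    have h3 := hasMFDerivAt_unique h1 h2
    exact h3
  have hv : ∀ v : EuclideanSpace ℝ (Fin n),
      (mfderiv (𝓡 n) (𝓡 n) (extChartAt (𝓡 n) p).symm x v : EuclideanSpace ℝ (Fin n)) = v :=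
    fun v => congrArg (fun A => A v) hd
  refine ContinuousLinearMap.ext fun v => ContinuousLinearMap.ext fun w => ?_
  refine (congrArg₂ (fun a b : EuclideanSpace ℝ (Fin n) =>
    conformalMetric ε α φ U ((extChartAt (𝓡 n) p).symm x) a b) (hv v) (hv w)).trans ?_
  refine (conformalMetric_apply ε α φ _ v w).trans ?_
  rw [extChartAt_symm_opens_val p hx]
  rfl

end OpenSubset

/-! ### The pseudo-Euclidean form and the invariant ξ. -/

section PseudoEuclidean

variable {n : ℕ} {ε : Fin n → ℝ}

theorem pseudoEuclidean_comm (ε : Fin n → ℝ) (v w : EuclideanSpace ℝ (Fin n)) :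
    pseudoEuclidean ε v w = pseudoEuclidean ε w v := by
  simp only [pseudoEuclidean_apply, mul_comm]

theorem pseudoEuclidean_nondeg (hε : ∀ i, ε i ≠ 0) (v : EuclideanSpace ℝ (Fin n))
    (hv : ∀ w, pseudoEuclidean ε v w = 0) : v = 0 := by
  ext i
  have := hv (EuclideanSpace.single i 1)
  simpa [pseudoEuclidean_apply, hε] using this

theorem pseudoEuclidean_basisFun (ε : Fin n → ℝ) (i j : Fin n) :
    pseudoEuclidean ε ((EuclideanSpace.basisFun (Fin n) ℝ).toBasis i)
      ((EuclideanSpace.basisFun (Fin n) ℝ).toBasis j) = if i = j then ε i else 0 := by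
  rcases eq_or_ne i j with rfl | h
  · simp [pseudoEuclidean_apply]
  · simp [pseudoEuclidean_apply, h, h.symm]

/-- `xi α` as a continuous linear form. -/
def xiL (α : Fin n → ℝ) : EuclideanSpace ℝ (Fin n) →L[ℝ] ℝ :=
  ∑ i, α i • (EuclideanSpace.proj i : EuclideanSpace ℝ (Fin n) →L[ℝ] ℝ)

theorem xiL_apply (α : Fin n → ℝ) (x : EuclideanSpace ℝ (Fin n)) : xiL α x = xi α x := by
  simp [xiL, xi]

/-- The gradient of `xi α` for `∑ i, ε i dx_i²`, where `ε i = ±1`. -/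
def xiGrad (ε α : Fin n → ℝ) : EuclideanSpace ℝ (Fin n) := WithLp.toLp 2 fun i => ε i * α i

theorem pseudoEuclidean_xiGrad (hε : ∀ i, ε i = 1 ∨ ε i = -1) (α : Fin n → ℝ)
    (z : EuclideanSpace ℝ (Fin n)) : pseudoEuclidean ε (xiGrad ε α) z = xiL α z := by
  rw [pseudoEuclidean_apply, xiL_apply, xi]
  refine Finset.sum_congr rfl fun i _ => ?_
  rcases hε i with h | h <;> simp [xiGrad, h]

theorem xiL_xiGrad (ε α : Fin n → ℝ) : xiL α (xiGrad ε α) = ∑ i, ε i * α i ^ 2 := by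
  rw [xiL_apply, xi]
  refine Finset.sum_congr rfl fun i _ => ?_
  simp only [xiGrad]
  ring

theorem xiL_ne_zero {α : Fin n → ℝ} (hα : α ≠ 0) : xiL α ≠ 0 := by
  intro h
  refine hα (funext fun i => ?_)
  have := congrArg (fun f => f (EuclideanSpace.single i 1)) h
  simpa [xiL_apply, xi] using this

theorem exists_xi_eq {α : Fin n → ℝ} (hα : α ≠ 0) (t : ℝ) : ∃ x, xi α x = t := by
  obtain ⟨i, hi⟩ := Function.ne_iff.mp hα
  refine ⟨EuclideanSpace.single i (t / α i), ?_⟩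
  simp at hi
  simp [xi]
  field_simp

end PseudoEuclidean

/-! ### Squares and inverses as weights. -/

section Weights

theorem differentiableAt_deriv {f : ℝ → ℝ} {t : ℝ} (hf : ContDiffAt ℝ 2 f t) :
    DifferentiableAt ℝ (deriv f) t :=
  ((hf.fderiv_right (m := 1) (by norm_num)).differentiableAt (by simp)).clm_apply
    (differentiableAt_const (1 : ℝ))

theorem isWeight_sq {f : ℝ → ℝ} {t : ℝ} (hf : ContDiffAt ℝ 2 f t) (h0 : f t ≠ 0) :
    IsWeight (fun s => f s ^ 2) (fun s => deriv f s / f s)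
      (deriv (deriv f) t / f t - (deriv f t / f t) ^ 2) t where
  contDiffAt := hf.pow 2
  ne_zero := by
    filter_upwards [hf.continuousAt.eventually_ne h0] with s hs using pow_ne_zero 2 hs
  deriv_weight := by
    filter_upwards [hf.continuousAt.eventually_ne h0, hf.eventually (by simp)] with s hs h2
    refine ((h2.differentiableAt (by simp)).hasDerivAt.pow 2).congr_deriv ?_
    field_simp
    norm_num
    ring
  deriv_log := by
    refine ((differentiableAt_deriv hf).hasDerivAt.div
      (hf.differentiableAt (by simp)).hasDerivAt h0).congr_deriv ?_
    field_simp

/-- Applied to φ², this produces the weight φ⁻² of the base, with logarithmic derivative -φ'/φ. -/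
theorem IsWeight.inv {w l : ℝ → ℝ} {l' t : ℝ} (h : IsWeight w l l' t) :
    IsWeight (fun s => 1 / w s) (fun s => - l s) (- l') t where
  contDiffAt := contDiffAt_const.div h.contDiffAt h.ne_zero.self_of_nhds
  ne_zero := by
    filter_upwards [h.ne_zero] with s hs using one_div_ne_zero hs
  deriv_weight := by
    filter_upwards [h.ne_zero, h.deriv_weight] with s hs h2
    refine ((hasDerivAt_const s (1 : ℝ)).div h2 hs).congr_deriv ?_
    field_simp
    ring
  deriv_log := h.deriv_log.neg

end Weights

/-! ### Derivatives of the explicit solutions. -/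

section PowerFunctions

theorem hasDerivAt_power {c c' d e t : ℝ} (hd : d ≠ 0) (ht : 0 < d * t + c) :
    HasDerivAt (fun s => c' * (d * s + c) ^ (-e / d))
      (-(e / (d * t + c)) * (c' * (d * t + c) ^ (-e / d))) t := by
  have h1 : HasDerivAt (fun s => d * s + c) d t := by
    simpa using ((hasDerivAt_id t).const_mul d).add_const c
  refine ((h1.rpow_const (p := -e / d) (Or.inl ht.ne')).const_mul c').congr_deriv ?_
  rw [Real.rpow_sub_one ht.ne']
  field_simp

/-- The exponent -e/d makes the logarithmic derivative -e/(dt + c). Since `f` is prescribed only on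
an open half-line, derivatives are taken through local equality. -/
theorem power_derivs {f : ℝ → ℝ} {c c' d e t : ℝ} (hd : d ≠ 0) (ht : 0 < d * t + c)
    (hf : ∀ s, 0 < d * s + c → f s = c' * (d * s + c) ^ (-e / d)) :
    ContDiffAt ℝ ∞ f t ∧ deriv f t = -(e / (d * t + c)) * f t ∧
      deriv (deriv f) t = (e ^ 2 + e * d) / (d * t + c) ^ 2 * f t := by
  have hopen : ∀ᶠ s in 𝓝 t, 0 < d * s + c :=
    (show Continuous fun s => d * s + c by fun_prop).continuousAt.eventually (lt_mem_nhds ht)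
  have he : ∀ s, 0 < d * s + c → f =ᶠ[𝓝 s] fun s => c' * (d * s + c) ^ (-e / d) := by
    intro s hs
    filter_upwards [(show Continuous fun s => d * s + c by fun_prop).continuousAt.eventually
      (lt_mem_nhds hs)] with u hu using hf u hu
  have hderiv : ∀ s, 0 < d * s + c → HasDerivAt f (-(e / (d * s + c)) * f s) s := by
    intro s hs
    rw [hf s hs]
    exact (hasDerivAt_power hd hs).congr_of_eventuallyEq (he s hs)
  refine ⟨?_, (hderiv t ht).deriv, ?_⟩
  · refine ContDiffAt.congr_of_eventuallyEq ?_ (he t ht)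
    have h1 : ContDiffAt ℝ ∞ (fun s => d * s + c) t := by fun_prop
    exact contDiffAt_const.mul (h1.rpow_const_of_ne ht.ne')
  · have h1 : HasDerivAt (fun s => d * s + c) d t := by
      simpa using ((hasDerivAt_id t).const_mul d).add_const c
    have h2 : deriv f =ᶠ[𝓝 t] fun s => -(e / (d * s + c)) * f s := by
      filter_upwards [hopen] with s hs using (hderiv s hs).deriv
    rw [h2.deriv_eq]
    have h3 := (((hasDerivAt_const t e).div h1 ht.ne').neg.fun_mul (hderiv t ht)).deriv
    refine Eq.trans h3 ?_
    simp
    field_simp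
    ring

end PowerFunctions

/-! ### The algebraic equation for N. -/

section Exponents

variable {n m r : ℕ} {k N : ℝ}

theorem exponent_eq (hr : 1 ≤ r)
    (hN : IsExponentOfNeOne n m r k N ∨ IsExponentOfEqOne n m r k N) :
    (r : ℝ) * (r - 1) * N ^ 2 - 2 * r * (k + coeffA n m k) * N
      + (coeffA n m k ^ 2 - coeffB n m k) = 0 := by
  rcases hN with ⟨h1, hdisc, hN⟩ | ⟨rfl, h0, rfl⟩
  · generalize coeffA n m k = a at *
    generalize coeffB n m k = b at *
    have hr0 : (0 : ℝ) < r := by exact_mod_cast hr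
    have hr1 : (r : ℝ) - 1 ≠ 0 := sub_ne_zero.mpr (by exact_mod_cast h1)
    -- The radicand is r times the difference of the two sides of the discriminant condition.
    have hD : 0 ≤ (r : ℝ) ^ 2 * (k + a) ^ 2 - r * ((r : ℝ) - 1) * (a ^ 2 - b) := by
      nlinarith [mul_nonneg hr0.le (sub_nonneg.mpr hdisc)]
    have hS := Real.sq_sqrt hD
    generalize √((r : ℝ) ^ 2 * (k + a) ^ 2 - r * ((r : ℝ) - 1) * (a ^ 2 - b)) = S at *
    have hc : (r : ℝ) * (r - 1) ≠ 0 := mul_ne_zero hr0.ne' hr1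
    have key : ((r : ℝ) * (r - 1) * N - r * (k + a)) ^ 2 = S ^ 2 := by
      rcases hN with rfl | rfl <;> field_simp <;> ring
    refine (mul_eq_zero.mp ?_).resolve_left hc
    linear_combination key + hS
  · push_cast
    field_simp
    ring

/-- If a = rN, multiplying the equation for N by r yields a² + r((n - 2)k² + m) = 0, a sum with a
positive term. -/
theorem exponent_ne (hn : 3 ≤ n) (hm : 1 ≤ m) (hr : 1 ≤ r)
    (hN : IsExponentOfNeOne n m r k N ∨ IsExponentOfEqOne n m r k N) :
    coeffA n m k - r * N ≠ 0 := by
  intro h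
  have he := exponent_eq hr hN
  have hr0 : (1 : ℝ) ≤ r := by exact_mod_cast hr
  have hn0 : (3 : ℝ) ≤ n := by exact_mod_cast hn
  have hm0 : (1 : ℝ) ≤ m := by exact_mod_cast hm
  have : coeffA n m k ^ 2 + r * (((n : ℝ) - 2) * k ^ 2 + m) = 0 := by
    have ha : coeffA n m k = r * N := by linarith
    have hb : 2 * k * coeffA n m k + coeffB n m k = ((n : ℝ) - 2) * k ^ 2 + m := by
      simp only [coeffA, coeffB]; ring
    rw [← hb]
    generalize coeffA n m k = a at *
    generalize coeffB n m k = b at *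
    subst ha
    linear_combination - r * he
  have h1 : 0 ≤ ((n : ℝ) - 2) * k ^ 2 := mul_nonneg (by linarith) (sq_nonneg k)
  have h2 : 0 < r * (((n : ℝ) - 2) * k ^ 2 + m) := mul_pos (by linarith) (by linarith)
  nlinarith [sq_nonneg (coeffA n m k)]

/-- For m = 1 the value d = -(1 + k) gives rN = (n - 1)k > 0, and the equation for N reduces to rN(N
+ k) = 0, impossible for positive N and k. -/
theorem exponent_ne_of_eq_one (hn : 3 ≤ n) (hm : m = 1) (hr : 1 ≤ r) (hk : 0 < k)
    (hN : IsExponentOfNeOne n m r k N ∨ IsExponentOfEqOne n m r k N) :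
    coeffA n m k - r * N ≠ -(1 + k) := by
  subst hm
  intro h
  have he := exponent_eq hr hN
  have hr0 : (1 : ℝ) ≤ r := by exact_mod_cast hr
  have hn0 : (3 : ℝ) ≤ n := by exact_mod_cast hn
  simp only [coeffA, coeffB] at h he
  push_cast at h he
  have hrN : (r : ℝ) * N = (n - 1) * k := by linarith
  have hpos : 0 < (r : ℝ) * N := by
    rw [hrN]; exact mul_pos (by linarith) hk
  have : (r : ℝ) * N * (N + k) = 0 := by
    linear_combination -he + (-2 * r * N + (n * k + r * N + k - 4 * k - 2) + k) * -hrN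
  have hN0 : 0 < N := by
    by_contra hneg
    push Not at hneg
    nlinarith
  nlinarith [mul_pos hpos (add_pos hN0 hk)]

end Exponents

/-! ### Ricci-flatness of the total space and conformal flatness of the base. -/

section Solutions

variable {n m r : ℕ} {ε α : Fin n → ℝ} {f h φ : ℝ → ℝ}
  {U : TopologicalSpace.Opens (EuclideanSpace ℝ (Fin n))}
  {F₁ : Type*} [TopologicalSpace F₁] [ChartedSpace (EuclideanSpace ℝ (Fin m)) F₁]
  [IsManifold (𝓡 m) ∞ F₁]
  {F₂ : Type*} [TopologicalSpace F₂] [ChartedSpace (EuclideanSpace ℝ (Fin r)) F₂]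
  [IsManifold (𝓡 r) ∞ F₂]

/-- `f` is a smooth function of `xi α` on `U`. -/
def SmoothOnXi (α : Fin n → ℝ) (U : TopologicalSpace.Opens (EuclideanSpace ℝ (Fin n)))
    (f : ℝ → ℝ) : Prop :=
  ∀ x ∈ U, ContDiffAt ℝ ∞ f (xi α x)

theorem SmoothOnXi.contDiffAt_comp (hf : SmoothOnXi α U f) {x : EuclideanSpace ℝ (Fin n)}
    (hx : x ∈ U) : ContDiffAt ℝ ∞ (fun x => f (xi α x)) x := by
  have h1 : ContDiffAt ℝ ∞ (xi α) x := by
    rw [show xi α = xiL α from funext fun x => (xiL_apply α x).symm]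
    exact (xiL α).contDiff.contDiffAt
  exact (hf x hx).comp x h1

theorem mem_of_mem_target {p : U} {x : EuclideanSpace ℝ (Fin n)}
    (hx : x ∈ (extChartAt (𝓡 n) p).target) : x ∈ U := by
  rw [← extChartAt_symm_opens_val p hx]
  exact ((extChartAt (𝓡 n) p).symm x).2

theorem isSemiRiemannianMetric_conformalMetric (hε : ∀ i, ε i = 1 ∨ ε i = -1)
    (hφ : SmoothOnXi α U φ) (hφ0 : ∀ x ∈ U, φ (xi α x) ≠ 0) :
    IsSemiRiemannianMetric (conformalMetric ε α φ U) where
  contDiffOn p := by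
    refine ContDiffOn.congr ?_ fun x hx => coordMetric_conformalMetric ε α φ p hx
    intro x hx
    have hxU := mem_of_mem_target hx
    exact ((contDiffAt_const.div ((hφ.contDiffAt_comp hxU).pow 2)
      (pow_ne_zero 2 (hφ0 x hxU))).smul contDiffAt_const).contDiffWithinAt
  symm p v w := (conformalMetric_apply ε α φ p v w).trans
    ((congrArg _ (pseudoEuclidean_comm ε v w)).trans (conformalMetric_apply ε α φ p w v).symm)
  nondegenerate p v hv := pseudoEuclidean_nondeg (ε := ε)
    (fun i => by rcases hε i with h | h <;> simp [h]) v fun w => by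
      have := (conformalMetric_apply ε α φ p v w).symm.trans (hv w)
      exact (mul_eq_zero.mp this).resolve_left (one_div_ne_zero (pow_ne_zero 2 (hφ0 _ p.2)))
  constant_index := by
    refine ⟨sigNeg
      (LinearMap.BilinMap.toQuadraticMap (pseudoEuclidean ε).toLinearMap₁₂), fun p => ?_⟩
    have hpos : 0 < 1 / φ (xi α p) ^ 2 := by
      have := hφ0 _ p.2
      positivity
    rw [← sigNeg_smul (LinearMap.BilinMap.toQuadraticMap (pseudoEuclidean ε).toLinearMap₁₂) hpos]
    refine congrArg sigNeg ?_
    ext v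
    exact conformalMetric_apply ε α φ p v v

theorem isManifold_one_of_infty {E H M : Type*} [NormedAddCommGroup E] [NormedSpace ℝ E]
    [TopologicalSpace H] {I : ModelWithCorners ℝ E H} [TopologicalSpace M] [ChartedSpace H M]
    [IsManifold I ∞ M] : IsManifold I 1 M :=
  IsManifold.of_le (n := ∞) (by norm_cast)

theorem isSemiRiemannianMetric_base (hε : ∀ i, ε i = 1 ∨ ε i = -1)
    (hφ : SmoothOnXi α U φ) (hφ0 : ∀ x ∈ U, φ (xi α x) ≠ 0) (hf : SmoothOnXi α U f)
    (hf0 : ∀ x ∈ U, 0 < f (xi α x)) {g₁ : BilinField (𝓡 m) F₁} (hg₁ : IsSemiRiemannianMetric g₁) :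
    IsSemiRiemannianMetric (warpedProduct (conformalMetric ε α φ U) (fun x => f (xi α x)) g₁) := by
  have := isManifold_one_of_infty (I := 𝓡 m) (M := F₁)
  refine (isSemiRiemannianMetric_conformalMetric hε hφ hφ0).warpedProduct (fun p => ?_)
    (fun p => hf0 _ p.2) hg₁
  refine ContDiffOn.congr (f := fun x => f (xi α x))
    (fun x hx => (hf.contDiffAt_comp (mem_of_mem_target hx)).contDiffWithinAt) fun x hx => ?_
  rw [extChartAt_symm_opens_val p hx]

theorem coordMetric_base (g₁ : BilinField (𝓡 m) F₁) (p : U × F₁)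
    {x : EuclideanSpace ℝ (Fin n) × EuclideanSpace ℝ (Fin m)}
    (hx : x ∈ (extChartAt ((𝓡 n).prod (𝓡 m)) p).target) :
    coordMetric (warpedProduct (conformalMetric ε α φ U) (fun x => f (xi α x)) g₁) p x
      = prodForm ((1 / φ (xi α x.1) ^ 2) • pseudoEuclidean ε)
        (f (xi α x.1) ^ 2 • coordMetric g₁ p.2 x.2) := by
  have := isManifold_one_of_infty (I := 𝓡 m) (M := F₁)
  have hx' := hx
  rw [extChartAt_prod] at hx'
  rw [coordMetric_warpedProduct _ _ _ p hx, coordMetric_conformalMetric ε α φ p.1 hx'.1,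
    extChartAt_symm_opens_val p.1 hx'.1]

theorem isSemiRiemannianMetric_total (hε : ∀ i, ε i = 1 ∨ ε i = -1)
    (hφ : SmoothOnXi α U φ) (hφ0 : ∀ x ∈ U, φ (xi α x) ≠ 0) (hf : SmoothOnXi α U f)
    (hf0 : ∀ x ∈ U, 0 < f (xi α x)) (hh : SmoothOnXi α U h)
    (hh0 : ∀ x ∈ U, 0 < h (xi α x)) {g₁ : BilinField (𝓡 m) F₁} (hg₁ : IsSemiRiemannianMetric g₁)
    {g₂ : BilinField (𝓡 r) F₂} (hg₂ : IsSemiRiemannianMetric g₂) :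
    IsSemiRiemannianMetric (warpedProduct
      (warpedProduct (conformalMetric ε α φ U) (fun x => f (xi α x)) g₁)
      (fun p => h (xi α p.1)) g₂) := by
  have := isManifold_one_of_infty (I := 𝓡 m) (M := F₁)
  have := isManifold_one_of_infty (I := 𝓡 r) (M := F₂)
  refine (isSemiRiemannianMetric_base hε hφ hφ0 hf hf0 hg₁).warpedProduct (fun p => ?_)
    (fun p => hh0 _ p.1.2) hg₂
  rw [extChartAt_prod]
  refine ContDiffOn.congr
    (f := fun x : EuclideanSpace ℝ (Fin n) × EuclideanSpace ℝ (Fin m) => h (xi α x.1))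
    (fun x hx => (ContDiffAt.comp (g := fun x => h (xi α x)) x
      (hh.contDiffAt_comp (mem_of_mem_target hx.1)) contDiffAt_fst).contDiffWithinAt) fun x hx => ?_
  exact congrArg (fun y => h (xi α y)) (extChartAt_symm_opens_val p.1 hx.1)

/-- The null equation together with the condition that `α` be null or that the logarithmic
derivatives satisfy a linear system makes the total space Ricci-flat. -/
theorem isRicciFlat_total (hε : ∀ i, ε i = 1 ∨ ε i = -1)
    (hφ : SmoothOnXi α U φ) (hφ0 : ∀ x ∈ U, φ (xi α x) ≠ 0) (hf : SmoothOnXi α U f)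
    (hf0 : ∀ x ∈ U, 0 < f (xi α x)) (hh : SmoothOnXi α U h)
    (hh0 : ∀ x ∈ U, 0 < h (xi α x)) {g₁ : BilinField (𝓡 m) F₁} (hg₁ : IsSemiRiemannianMetric g₁)
    (hRic₁ : IsRicciFlat g₁)
    {g₂ : BilinField (𝓡 r) F₂} (hg₂ : IsSemiRiemannianMetric g₂) (hRic₂ : IsRicciFlat g₂)
    (hode : ∀ x ∈ U, ∀ t, t = xi α x →
      -(r : ℝ) * f t * φ t * deriv (deriv h) t - 2 * r * f t * deriv φ t * deriv h t
      + (((n : ℝ) - 2) * f t * deriv (deriv φ) t - m * φ t * deriv (deriv f) t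
        - 2 * m * deriv φ t * deriv f t) * h t = 0)
    (hη : ∑ i, ε i * α i ^ 2 = 0 ∨ ∀ x ∈ U, ∀ t, t = xi α x → ∃ s : ℝ,
      s = -((n : ℝ) - 2) * -(deriv φ t / φ t) - m * (deriv f t / f t) - r * (deriv h t / h t) ∧
      -(deriv (deriv φ) t / φ t - (deriv φ t / φ t) ^ 2) = s * -(deriv φ t / φ t) ∧
      deriv (deriv f) t / f t - (deriv f t / f t) ^ 2 = s * (deriv f t / f t) ∧
      deriv (deriv h) t / h t - (deriv h t / h t) ^ 2 = s * (deriv h t / h t)) :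
    IsRicciFlat (warpedProduct
      (warpedProduct (conformalMetric ε α φ U) (fun x => f (xi α x)) g₁)
      (fun p => h (xi α p.1)) g₂) := by
  have := isManifold_one_of_infty (I := 𝓡 m) (M := F₁)
  have := isManifold_one_of_infty (I := 𝓡 r) (M := F₂)
  rintro ⟨⟨q, p₁⟩, p₂⟩ v w
  rw [zero_mul, ricciAt]
  have hq : q.1 ∈ U := q.2
  have hge : coordMetric (warpedProduct
      (warpedProduct (conformalMetric ε α φ U) (fun x => f (xi α x)) g₁)
      (fun p => h (xi α p.1)) g₂) ((q, p₁), p₂) =ᶠ[𝓝 ((q.1, extChartAt (𝓡 m) p₁ p₁),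
        extChartAt (𝓡 r) p₂ p₂)] fun y => prodForm (prodForm
          ((fun t => 1 / φ t ^ 2) (xiL α y.1.1) • pseudoEuclidean ε)
          ((fun t => f t ^ 2) (xiL α y.1.1) • coordMetric g₁ p₁ y.1.2))
        ((fun t => h t ^ 2) (xiL α y.1.1) • coordMetric g₂ p₂ y.2) := by
    have hmem := extChartAt_target_mem_nhds (I := ((𝓡 n).prod (𝓡 m)).prod (𝓡 r)) ((q, p₁), p₂)
    filter_upwards [hmem] with y hy
    have hy' := hy
    rw [extChartAt_prod] at hy'
    have hy'' := hy'.1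
    rw [extChartAt_prod] at hy''
    rw [coordMetric_warpedProduct _ _ _ _ hy, coordMetric_base g₁ (q, p₁) hy'.1]
    simp only [xiL_apply]
    have : h (xi α ((extChartAt ((𝓡 n).prod (𝓡 m)) (q, p₁)).symm y.1).1) = h (xi α y.1.1) :=
      congrArg (fun y => h (xi α y)) (extChartAt_symm_opens_val q hy''.1)
    rw [this]
  have hc : extChartAt (((𝓡 n).prod (𝓡 m)).prod (𝓡 r)) ((q, p₁), p₂) ((q, p₁), p₂)
    = ((q.1, extChartAt (𝓡 m) p₁ p₁), extChartAt (𝓡 r) p₂ p₂) := rfl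
  rw [hc, ricci_congr hge]
  have hB₁ := MetricGerm.coordMetric hg₁ p₁ (mem_extChartAt_target p₁)
  have hB₂ := MetricGerm.coordMetric hg₂ p₂ (mem_extChartAt_target p₂)
  have h2 : ∀ {u : ℝ → ℝ} {t : ℝ}, ContDiffAt ℝ ∞ u t → ContDiffAt ℝ 2 u t :=
    fun hu => hu.of_le (by norm_cast)
  have hx := xiL_apply α q.1
  have e0 := hφ0 q.1 hq
  have e1 := (hf0 q.1 hq).ne'
  have e2 := (hh0 q.1 hq).ne'
  have w0 := (isWeight_sq (h2 (hφ q.1 hq)) e0).inv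
  have w1 := isWeight_sq (h2 (hf q.1 hq)) e1
  have w2 := isWeight_sq (h2 (hh q.1 hq)) e2
  have hode' := hode q.1 hq _ rfl
  have hη' := hη.imp_right fun H => H q.1 hq _ rfl
  rw [← hx] at e0 e1 e2 w0 w1 w2 hode' hη'
  refine ricci_doublyWarped (pseudoEuclidean_comm ε)
    (pseudoEuclidean_nondeg (fun i => by rcases hε i with h | h <;> simp [h]))
    (pseudoEuclidean_xiGrad hε α) hB₁ hB₂ (fun v w => (hRic₁ p₁ v w).trans (zero_mul _))
    (fun v w => (hRic₂ p₂ v w).trans (zero_mul _)) w0 w1 w2 rfl ?_ ?_ v w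
  -- Here k₀ = -φ''/φ, k₁ = f''/f + 2φ'f'/(φf), and likewise k₂ with h; the trace condition is the
  -- differential equation divided by -fφh.
  · simp only [finrank_euclideanSpace_fin]
    generalize xiL α q.1 = t at *
    field_simp
    linear_combination -(φ t * f t * h t) * hode'
  · rw [xiL_xiGrad]
    refine hη'.imp_right ?_
    rintro ⟨s, hs, h0, h1, h2⟩
    simp only [finrank_euclideanSpace_fin]
    rw [h0, h1, h2, hs]
    refine ⟨?_, ?_, ?_⟩ <;> ring

/-- Consequences of local conformal flatness of the base. -/
theorem base_of_isLocallyConformallyFlat (hn : 3 ≤ n) (hm : 1 ≤ m) (hε : ∀ i, ε i = 1 ∨ ε i = -1)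
    (hα : α ≠ 0) (hφ : SmoothOnXi α U φ) (hφ0 : ∀ x ∈ U, φ (xi α x) ≠ 0) (hf : SmoothOnXi α U f)
    (hf0 : ∀ x ∈ U, 0 < f (xi α x)) {g₁ : BilinField (𝓡 m) F₁} (hg₁ : IsSemiRiemannianMetric g₁)
    (hflat : IsLocallyConformallyFlat
      (warpedProduct (conformalMetric ε α φ U) (fun x => f (xi α x)) g₁))
    (x : EuclideanSpace ℝ (Fin n)) (hx : x ∈ U) (p₁ : F₁) :
    deriv (deriv fun t => f t * φ t) (xi α x) = 0 ∧ ∀ u v z,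
      riemann (coordMetric g₁ p₁) (extChartAt (𝓡 m) p₁ p₁) v z u
        = ((∑ i, ε i * α i ^ 2) * deriv (fun t => f t * φ t) (xi α x) ^ 2) •
          (coordMetric g₁ p₁ (extChartAt (𝓡 m) p₁ p₁) v z • u
            - coordMetric g₁ p₁ (extChartAt (𝓡 m) p₁ p₁) u z • v) := by
  have := isManifold_one_of_infty (I := 𝓡 m) (M := F₁)
  have : Nonempty (Fin m) := ⟨⟨0, hm⟩⟩
  have hB₁ := MetricGerm.coordMetric hg₁ p₁ (mem_extChartAt_target p₁)
  obtain ⟨V, hV, hpV, μ, hμ, hμ0, hR⟩ := hflat (⟨x, hx⟩, p₁)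
  set p : U × F₁ := (⟨x, hx⟩, p₁)
  set c := extChartAt ((𝓡 n).prod (𝓡 m)) p p with hcdef
  set ν : EuclideanSpace ℝ (Fin n) × EuclideanSpace ℝ (Fin m) → ℝ :=
    fun y => μ ((extChartAt ((𝓡 n).prod (𝓡 m)) p).symm y) with hν
  have hνd : ContDiffAt ℝ 2 ν c := by
    have h1 := (contMDiffAt_iff.mp (hμ.contMDiffAt (hV.mem_nhds hpV))).2
    rw [ModelWithCorners.range_eq_univ, contDiffWithinAt_univ] at h1
    exact h1.of_le (by norm_cast)
  have hνpos : 0 < ν c := by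
    rw [hν, hcdef]
    simp only [extChartAt_to_inv]
    exact hμ0 p hpV
  have h2 : ∀ {u : ℝ → ℝ} {t : ℝ}, ContDiffAt ℝ ∞ u t → ContDiffAt ℝ 2 u t :=
    fun hu => hu.of_le (by norm_cast)
  have hφd : ContDiffAt ℝ 2 (fun y : EuclideanSpace ℝ (Fin n) × EuclideanSpace ℝ (Fin m) =>
      φ (xi α y.1)) c :=
    ContDiffAt.comp (g := fun x => φ (xi α x)) c ((hφ.contDiffAt_comp hx).of_le (by norm_cast))
      contDiffAt_fst
  -- ν/φ² is the conformal factor relative to g ⊕ (fφ)² g₁; half its logarithm serves as the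
  -- exponent below.
  have hσd : ContDiffAt ℝ 2 (fun y => ν y / φ (xi α y.1) ^ 2) c :=
    hνd.div (hφd.pow 2) (pow_ne_zero 2 (hφ0 x hx))
  have hσpos : 0 < ν c / φ (xi α c.1) ^ 2 := div_pos hνpos (by have := hφ0 x hx; positivity)
  have hw := isWeight_sq ((h2 (hf x hx)).mul (h2 (hφ x hx)))
    (mul_ne_zero (hf0 x hx).ne' (hφ0 x hx))
  have hwne := mul_ne_zero (hf0 x hx).ne' (hφ0 x hx)
  have hxx := xiL_apply α x
  rw [← hxx] at hw hwne
  have key := warped_of_conformally_flat hn (EuclideanSpace.basisFun (Fin n) ℝ).toBasis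
    (ε := ε) (b := pseudoEuclidean ε) (fun i => by rcases hε i with h | h <;> simp [h])
    (pseudoEuclidean_basisFun ε) (pseudoEuclidean_comm ε)
    (pseudoEuclidean_nondeg (fun i => by rcases hε i with h | h <;> simp [h]))
    (xiL_ne_zero hα) (pseudoEuclidean_xiGrad hε α) hB₁ hw
    (f := fun y => (1 / 2) * Real.log (ν y / φ (xi α y.1) ^ 2))
    (G := coordMetric (fun q => μ q • warpedProduct (conformalMetric ε α φ U)
      (fun x => f (xi α x)) g₁ q) p)
    (contDiffAt_const.mul (hσd.log hσpos.ne')) ?_ (fun u v w => hR p hpV u v w)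
  · obtain ⟨k1, k2⟩ := key
    rw [← hxx]
    refine ⟨?_, fun u v z => ?_⟩
    -- For l = (fφ)'/(fφ), the quantity l' + l² is (fφ)''/(fφ).
    · have : deriv (deriv fun t => f t * φ t) (xiL α x) / (f (xiL α x) * φ (xiL α x)) = 0 := by
        simpa using k1
      exact (div_eq_zero_iff.mp this).resolve_right hwne
    · rw [k2, xiL_xiGrad]
      congr 1
      generalize f (xiL α x) * φ (xiL α x) = W at *
      field_simp
  · filter_upwards [extChartAt_target_mem_nhds (I := (𝓡 n).prod (𝓡 m)) p,
      hσd.continuousAt.eventually (lt_mem_nhds hσpos),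
      hφd.continuousAt.eventually_ne (hφ0 x hx)] with y hy h1 h3
    rw [coordMetric_smul, coordMetric_base g₁ p hy]
    rw [show (2 : ℝ) * (1 / 2 * Real.log (ν y / φ (xi α y.1) ^ 2))
      = Real.log (ν y / φ (xi α y.1) ^ 2) by ring, Real.exp_log h1]
    refine ContinuousLinearMap.ext fun v => ContinuousLinearMap.ext fun w => ?_
    simp only [smul_apply, prodForm_apply, smul_eq_mul, xiL_apply]
    field_simp
    rfl

end Solutions

/-! ### The differential equation for power functions. -/

section Solutions

variable {n m r : ℕ} {J : Set ℝ} {f h φ : ℝ → ℝ}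

/-- Every term carries the factor FΦH/s²; once d = a - rN is inserted, the remaining coefficient is
the left side of `exponent_eq`. -/
theorem ode_of_power {k N d s : ℝ} (hr : 1 ≤ r) (hs : s ≠ 0)
    (hN : IsExponentOfNeOne n m r k N ∨ IsExponentOfEqOne n m r k N)
    (hd : d = coeffA n m k - r * N) (F Φ H : ℝ) :
    -(r : ℝ) * F * Φ * ((N ^ 2 + N * d) / s ^ 2 * H)
      - 2 * r * F * (-(k / s) * Φ) * (-(N / s) * H)
      + (((n : ℝ) - 2) * F * ((k ^ 2 + k * d) / s ^ 2 * Φ)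
        - m * Φ * ((1 ^ 2 + 1 * d) / s ^ 2 * F)
        - 2 * m * (-(k / s) * Φ) * (-(1 / s) * F)) * H = 0 := by
  have he := exponent_eq hr hN
  have hb : -(r : ℝ) * (N ^ 2 + N * d) - 2 * r * k * N + ((n : ℝ) - 2) * (k ^ 2 + k * d)
      - m * (1 + d) - 2 * m * k = 0 := by
    subst hd
    simp only [coeffA, coeffB] at he ⊢
    linear_combination he
  field_simp
  linear_combination (F * Φ * H) * hb

end Solutions

end SemiRiem

end

/-! ### The main theorem. -/

theorem mainTheorem10 {n m r : ℕ} (hn : 3 ≤ n) (hm : 1 ≤ m) (hr : 1 ≤ r)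
    (ε α : Fin n → ℝ) (hε : ∀ i, ε i = 1 ∨ ε i = -1)
    (J : Set ℝ) (f h φ : ℝ → ℝ)
    (U : TopologicalSpace.Opens (EuclideanSpace ℝ (Fin n)))
    (hU : (U : Set (EuclideanSpace ℝ (Fin n))) = SemiRiem.solutionDomain α J f h φ)
    {F₁ : Type*} [TopologicalSpace F₁] [ChartedSpace (EuclideanSpace ℝ (Fin m)) F₁]
    [IsManifold (𝓡 m) ∞ F₁] [Nonempty F₁]
    {F₂ : Type*} [TopologicalSpace F₂] [ChartedSpace (EuclideanSpace ℝ (Fin r)) F₂]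
    [IsManifold (𝓡 r) ∞ F₂] [Nonempty F₂]
    (g₁ : SemiRiem.BilinField (𝓡 m) F₁) (hg₁ : SemiRiem.IsSemiRiemannianMetric g₁)
    (hRic₁ : SemiRiem.IsRicciFlat g₁)
    (g₂ : SemiRiem.BilinField (𝓡 r) F₂) (hg₂ : SemiRiem.IsSemiRiemannianMetric g₂)
    (hRic₂ : SemiRiem.IsRicciFlat g₂)
    (gB : SemiRiem.BilinField ((𝓡 n).prod (𝓡 m)) (U × F₁))
    (hgB : gB = SemiRiem.warpedProduct (SemiRiem.conformalMetric ε α φ U)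
      (fun x => f (SemiRiem.xi α x)) g₁)
    (g : SemiRiem.BilinField (((𝓡 n).prod (𝓡 m)).prod (𝓡 r)) ((U × F₁) × F₂))
    (hg : g = SemiRiem.warpedProduct gB (fun p => h (SemiRiem.xi α p.1)) g₂) :
    ((∃ i₀, ∑ i, ε i * α i ^ 2 = ε i₀) → SemiRiem.IsPowerSolution n m r J f h φ →
      SemiRiem.IsSemiRiemannianMetric g ∧ SemiRiem.IsRicciFlat g ∧
        ¬ SemiRiem.IsLocallyConformallyFlat gB) ∧
    (∑ i, ε i * α i ^ 2 = 0 → SemiRiem.IsNullSolution n m r J f h φ →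
      SemiRiem.IsSemiRiemannianMetric g ∧ SemiRiem.IsRicciFlat g ∧
        (α ≠ 0 → (U : Set (EuclideanSpace ℝ (Fin n))).Nonempty →
          ¬ ((∀ x ∈ U, deriv (deriv (fun t => f t * φ t)) (SemiRiem.xi α x) = 0) ∧
            SemiRiem.IsFlatOn g₁ Set.univ) →
          ¬ SemiRiem.IsLocallyConformallyFlat gB)) := by
  subst hg hgB
  have hmem : ∀ x, x ∈ U ↔ SemiRiem.xi α x ∈ J ∧ 0 < f (SemiRiem.xi α x) ∧
      0 < h (SemiRiem.xi α x) ∧ φ (SemiRiem.xi α x) ≠ 0 := fun x => by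
    rw [← SetLike.mem_coe, hU]; rfl
  have hf0 : ∀ x ∈ U, 0 < f (SemiRiem.xi α x) := fun x hx => ((hmem x).mp hx).2.1
  have hh0 : ∀ x ∈ U, 0 < h (SemiRiem.xi α x) := fun x hx => ((hmem x).mp hx).2.2.1
  have hφ0 : ∀ x ∈ U, φ (SemiRiem.xi α x) ≠ 0 := fun x hx => ((hmem x).mp hx).2.2.2
  have hJ : ∀ x ∈ U, SemiRiem.xi α x ∈ J := fun x hx => ((hmem x).mp hx).1
  obtain ⟨p₁⟩ := ‹Nonempty F₁›
  constructor
  · rintro ⟨i₀, hi₀⟩ ⟨k, c, c₁, c₂, c₃, N, d, hk, hc₁, hc₂, hc₃, hN, hd, rfl, hsol⟩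
    have hd0 : d ≠ 0 := hd ▸ SemiRiem.exponent_ne hn hm hr hN
    have hη : ∑ i, ε i * α i ^ 2 ≠ 0 := by
      rw [hi₀]
      rcases hε i₀ with h | h <;> simp [h]
    have hα : α ≠ 0 := by
      rintro rfl
      simp at hη
    have hfp := fun {t} ht => SemiRiem.power_derivs (e := 1) (t := t) hd0 ht
      fun s hs => (hsol s hs).1
    have hhp := fun {t} ht => SemiRiem.power_derivs (e := N) (t := t) hd0 ht
      fun s hs => (hsol s hs).2.1
    have hφp := fun {t} ht => SemiRiem.power_derivs (e := k) (t := t) hd0 ht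
      fun s hs => (hsol s hs).2.2
    have hf : SemiRiem.SmoothOnXi α U f := fun x hx => (hfp (hJ x hx)).1
    have hh : SemiRiem.SmoothOnXi α U h := fun x hx => (hhp (hJ x hx)).1
    have hφ : SemiRiem.SmoothOnXi α U φ := fun x hx => (hφp (hJ x hx)).1
    refine ⟨SemiRiem.isSemiRiemannianMetric_total hε hφ hφ0 hf hf0 hh hh0 hg₁ hg₂,
      SemiRiem.isRicciFlat_total hε hφ hφ0 hf hf0 hh hh0 hg₁ hRic₁ hg₂ hRic₂ ?_ (Or.inr ?_), ?_⟩
    · rintro x hx t rfl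
      have hs : 0 < d * SemiRiem.xi α x + c := hJ x hx
      rw [(hfp hs).2.1, (hfp hs).2.2, (hhp hs).2.1, (hhp hs).2.2, (hφp hs).2.1, (hφp hs).2.2]
      exact SemiRiem.ode_of_power hr hs.ne' hN hd _ _ _
    · rintro x hx t rfl
      have hs : 0 < d * SemiRiem.xi α x + c := hJ x hx
      have e1 := (hf0 x hx).ne'
      have e2 := (hh0 x hx).ne'
      have e3 := hφ0 x hx
      have hs' := hs.ne'
      -- Each logarithmic derivative is a constant over dξ + c, so its derivative is -d/(dξ + c)
      -- times itself; the trace identity for this factor is d = a - rN.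
      refine ⟨-(d / (d * SemiRiem.xi α x + c)), ?_, ?_, ?_, ?_⟩ <;>
        simp only [(hfp hs).2.1, (hfp hs).2.2, (hhp hs).2.1, (hhp hs).2.2, (hφp hs).2.1,
          (hφp hs).2.2, mul_div_assoc, div_self e1, div_self e2, div_self e3, mul_one] <;>
        field_simp
      · rw [hd, SemiRiem.coeffA]
        ring
      all_goals ring
    · intro hflat
      -- This value of ξ makes dξ + c = 1, which shows that `U` is not empty.
      obtain ⟨x, hx⟩ := SemiRiem.exists_xi_eq hα ((1 - c) / d)
      have hs : 0 < d * SemiRiem.xi α x + c := by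
        rw [hx]
        field_simp
        norm_num
      have hxU : x ∈ U := by
        obtain ⟨h1, h2, h3⟩ := hsol _ hs
        rw [hmem, h1, h2, h3]
        exact ⟨hs, by positivity, by positivity, by positivity⟩
      obtain ⟨h1, h2⟩ := SemiRiem.base_of_isLocallyConformallyFlat hn hm hε hα hφ hφ0 hf hf0 hg₁
        hflat x hxU p₁
      have hF := SemiRiem.power_derivs (f := fun t => f t * φ t) (c' := c₁ * c₃) (e := 1 + k) hd0 hs
        fun s hs => by
          rw [(hsol s hs).1, (hsol s hs).2.2, show -(1 + k) / d = -1 / d + -k / d by ring,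
            Real.rpow_add hs]
          ring
      have hF0 : f (SemiRiem.xi α x) * φ (SemiRiem.xi α x) ≠ 0 :=
        mul_ne_zero (hf0 x hxU).ne' (hφ0 x hxU)
      have hk1 : 1 + k ≠ 0 := by positivity
      -- fφ is a power with exponent -(1 + k)/d, so its second derivative vanishes only when this
      -- exponent is 1, as 1 + k ≠ 0.
      have hdk : d = -(1 + k) := by
        rw [hF.2.2] at h1
        have h3 := (mul_eq_zero.mp h1).resolve_right hF0
        have h4 : (1 + k) * (1 + k + d) = 0 := by
          have := (div_eq_zero_iff.mp h3).resolve_right (pow_ne_zero 2 hs.ne')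
          linear_combination this
        have := (mul_eq_zero.mp h4).resolve_left hk1
        linarith
      have : Nonempty (Fin m) := ⟨⟨0, hm⟩⟩
      have := SemiRiem.isManifold_one_of_infty (I := 𝓡 m) (M := F₁)
      have hm1 := SemiRiem.finrank_eq_one_of_riemann_eq
        (SemiRiem.MetricGerm.coordMetric hg₁ p₁ (mem_extChartAt_target p₁))
        (fun v w => (hRic₁ p₁ v w).trans (zero_mul _)) (mul_ne_zero hη (pow_ne_zero 2 (by
          rw [hF.2.1]
          exact mul_ne_zero (neg_ne_zero.mpr (div_ne_zero hk1 hs.ne')) hF0))) h2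
      rw [finrank_euclideanSpace_fin] at hm1
      exact SemiRiem.exponent_ne_of_eq_one hn hm1 hr hk hN (hd ▸ hdk)
  · rintro hη ⟨hJo, hfJ, hhJ, hφJ, hode⟩
    have hf : SemiRiem.SmoothOnXi α U f := fun x hx => hfJ.contDiffAt (hJo.mem_nhds (hJ x hx))
    have hh : SemiRiem.SmoothOnXi α U h := fun x hx => hhJ.contDiffAt (hJo.mem_nhds (hJ x hx))
    have hφ : SemiRiem.SmoothOnXi α U φ := fun x hx => hφJ.contDiffAt (hJo.mem_nhds (hJ x hx))
    refine ⟨SemiRiem.isSemiRiemannianMetric_total hε hφ hφ0 hf hf0 hh hh0 hg₁ hg₂,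
      SemiRiem.isRicciFlat_total hε hφ hφ0 hf hf0 hh hh0 hg₁ hRic₁ hg₂ hRic₂ ?_ (Or.inl hη), ?_⟩
    · rintro x hx t rfl
      exact hode _ (hJ x hx)
    · rintro hα ⟨x₀, hx₀⟩ hne hflat
      have key := SemiRiem.base_of_isLocallyConformallyFlat hn hm hε hα hφ hφ0 hf hf0 hg₁ hflat
      refine hne ⟨fun x hx => (key x hx p₁).1, fun p _ u v w => ?_⟩
      -- A single point x₀ of `U` suffices for every point of the fibre: the constant curvature
      -- carries the factor |α|² = 0.
      rw [SemiRiem.curvatureAt, (key x₀ hx₀ p).2, hη]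
      simp
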